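/- Let $\mathbb D$ be the open unit disc, $\mathbb T$ the unit circle, $dA=\frac1\pi\,dx\,dy$, and $H(\mathbb D)$ the space of analytic functions on $\mathbb D$. For an arc $I\subset\mathbb T$ of positive normalized length $|I|=\int_I\frac{|d\zeta|}{2\pi}$ let $S(I)=\{z\in\mathbb D: 1-|I|\le|z|<1,\ z/|z|\in I\}$. For $s>0$, a positive Borel measure $\mu$ on $\mathbb D$ is an $s$-Carleson measure if $\sup_{I\subset\mathbb T}\mu(S(I))/|I|^s<\infty$, the supremum being over all such arcs. For $1/2<\beta\le1$ and $2-2\beta<p\le1$ let $Q_p^\beta(\mathbb D)$ be the set of all $f\in H(\mathbb D)$ with $$\sup_{I\subset\mathbb T}\frac1{|I|^{p+2-2\beta}}\int_{S(I)}|f'(z)|^2(1-|z|^2)^{p-2+2\beta}\,dA(z)<\infty .$$ Fix $b>1$. For $\nu>0$ and $f\in H(\mathbb D)$ the $\nu$-derivative of $f$ (with parameter $b$) is $$f^{(\nu)}(z)=\frac{\Gamma(b+\nu)}{\Gamma(b)}\int_{\mathbb D}\frac{\overline w^{\,\lceil\nu-1\rceil}f'(w)}{(1-\overline w z)^{b+\nu}}(1-|w|^2)^{b-1}\,dA(w),\qquad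 z\in\mathbb D,$$ with the principal branch of the power; it is said to be defined if the integral converges absolutely for every $z\in\mathbb D$. **Theorem.** Let $1/2<\beta\le1$, $2-2\beta<p\le1$, $\nu>\max\{(3-p-2\beta)/2,\ 2-2\beta\}$ and $b>1$. Let $f\in H(\mathbb D)$. Then $f\in Q_p^\beta(\mathbb D)$ if and only if $f^{(\nu)}$ is defined and $$|f^{(\nu)}(z)|^2(1-|z|^2)^{2\nu+p+2\beta-4}\,dA(z)$$ is a $(p+2-2\beta)$-Carleson measure. -/

import Mathlib

open MeasureTheory Set
open scoped ENNReal NNReal ComplexConjugate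

noncomputable section

/-- The normalized Lebesgue area measure `dA = π⁻¹ dx dy` on the open unit disc (as a measure on `ℂ`
that vanishes off the disc). -/
def diskArea : Measure ℂ :=
  ENNReal.ofReal (Real.pi⁻¹) • (volume : Measure ℂ).restrict (Metric.ball 0 1)

/-- The arc `{exp (i t) : a ≤ t ≤ b}` of the unit circle. It is used for `a < b ≤ a + 2π`.
Every nondegenerate arc (open, closed or half-open) is contained in one of these of the same length,
so the suprema below, whose terms increase with the box for a given length, would be the same
over all arcs. -/
def circleArc (a b : ℝ) : Set ℂ :=
  (fun t : ℝ => Complex.exp (t * Complex.I)) '' Icc a b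

/-- Normalized length `|I| = ∫_I |dζ| / 2π` of the arc `I = circleArc a b`, `a < b ≤ a + 2π`. -/
def arcLength (a b : ℝ) : ℝ := (b - a) / (2 * Real.pi)

/-- The Carleson box `S(I) = {z ∈ 𝔻 : 1 - |I| ≤ |z| < 1, z / |z| ∈ I}` over `I = circleArc a b`. -/
def carlesonBox (a b : ℝ) : Set ℂ :=
  {z : ℂ | 1 - arcLength a b ≤ ‖z‖ ∧ ‖z‖ < 1 ∧ z / (‖z‖ : ℂ) ∈ circleArc a b}

/-- `μ` is an `s`-Carleson measure: `sup_I μ(S(I)) / |I|^s < ∞` over all arcs `I`. -/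
def IsCarlesonMeasure (s : ℝ) (μ : Measure ℂ) : Prop :=
  ∃ C : ℝ≥0, ∀ a b : ℝ, a < b → b ≤ a + 2 * Real.pi →
    μ (carlesonBox a b) ≤ C * ENNReal.ofReal (arcLength a b ^ s)

/-- Membership in `Q_p^β(𝔻)`: `f` is analytic on the disc and
`sup_I |I|^{-(p+2-2β)} ∫_{S(I)} |f'(z)|² (1-|z|²)^{p-2+2β} dA(z) < ∞` over all arcs `I`. -/
def MemQ (p β : ℝ) (f : ℂ → ℂ) : Prop :=
  DifferentiableOn ℂ f (Metric.ball 0 1) ∧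
  ∃ C : ℝ≥0, ∀ a b : ℝ, a < b → b ≤ a + 2 * Real.pi →
    ∫⁻ z in carlesonBox a b,
        ENNReal.ofReal (‖deriv f z‖ ^ 2 * (1 - ‖z‖ ^ 2) ^ (p - 2 + 2 * β)) ∂diskArea
      ≤ C * ENNReal.ofReal (arcLength a b ^ (p + 2 - 2 * β))

/-- The integrand
`w̄^m f'(w) (1 - w̄ z)^{-(b+ν)} (1-|w|²)^{b-1}` of the `ν`-derivative at `z`, where `m` is the
smallest integer `≥ ν - 1` (which is `≥ 0` as `ν > 0`). The power is the principal one;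
`1 - w̄ z` has positive real part for `z`, `w` in the disc. -/
def fracDerivIntegrand (b ν : ℝ) (f : ℂ → ℂ) (z w : ℂ) : ℂ :=
  conj w ^ ⌈ν - 1⌉₊ * deriv f w / (1 - conj w * z) ^ ((b + ν : ℝ) : ℂ)
    * (((1 - ‖w‖ ^ 2) ^ (b - 1) : ℝ) : ℂ)

/-- The `ν`-derivative of `f` (with parameter `b`) is defined on the disc: its integral converges
absolutely at every point. -/
def HasFracDeriv (b ν : ℝ) (f : ℂ → ℂ) : Prop :=
  ∀ z ∈ Metric.ball (0 : ℂ) 1, Integrable (fracDerivIntegrand b ν f z) diskArea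

/-- The `ν`-derivative
`f^{(ν)}(z) = Γ(b+ν)/Γ(b) ∫_𝔻 w̄^m f'(w) (1 - w̄ z)^{-(b+ν)} (1-|w|²)^{b-1} dA(w)`. -/
def fracDeriv (b ν : ℝ) (f : ℂ → ℂ) (z : ℂ) : ℂ :=
  ((Real.Gamma (b + ν) / Real.Gamma b : ℝ) : ℂ) * ∫ w, fracDerivIntegrand b ν f z w ∂diskArea

end

/-!
Put `d(z) = 1 - |z|²`, `s = p + 2 - 2β` and `α = p - 2 + 2β`. Both sides of the equivalence say that
a density `u² dA` is an `s`-Carleson measure: `u = |f'| d^(α/2)` on the left and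
`u = |f^(ν)| d^(α/2 + ν - 1)` on the right. Each of the two functions is dominated by a Bergman-type
integral operator applied to the other one, so the theorem follows from the fact that the operators
with kernel `d(z)^x d(w)^y / |1 - w̄ z|^(2+x+y)`, `x, y > -1/2`, preserve the Carleson condition when
`s < 2 + 2x` (`IsSqCarleson.lintegral_bergmanKernel`).

For that fact, Carleson boxes are replaced by discs of radius `r` around points `ξ` of the circle
(`isCarlesonMeasure_iff_ball`). The part of `u` within `2r` of `ξ` is handled by boundedness on
`L²(dA)`, which is Schur's test with test function `d^(-1/2)` and the Forelli-Rudin estimate. For the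
remaining part `|1 - w̄ z| ≥ |w - z| ≥ |w - ξ| / 2`, and a sum over dyadic discs with the
Cauchy-Schwarz inequality gives a bound of the right order.

That `f^(ν)` is dominated by an integral of `|f'|` is its definition; here `x = α/2 + ν - 1`, and
`s < 2 + 2x` means `ν > 2 - 2β`. Conversely, let `f' = ∑ a_n z^n` and `m = ⌈ν - 1⌉`. Since
`∫ w̄^k F(w) d(w)^(c-1) dA` is the `k`-th coefficient of `F` times the moment
`∫ |w|^(2k) d(w)^(c-1) dA`, and this moment is `1/c` over the `k`-th coefficient of
`(1 - ζ)^(-(c+1))`, integrating `f^(ν)(w) d(w)^(b+ν-2)` against the tail from order `m` of the series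
of `(1 - w̄ z)^(-(b+1))`, divided by `w̄^m`, returns a multiple of `∑_{n ≥ m} a_n z^n`
(`exists_enorm_deriv_le`). Now `x = α/2`, and `s < 2 + 2x` means `β > 1/2`. The missing polynomial
is bounded, and `d^α dA` is itself `s`-Carleson.
-/

/-! ### Weighted area of discs centred on the circle, and Carleson boxes -/

/-- The weight `(1 - |w|²)^t` as an extended nonnegative real. -/
noncomputable def diskWeight (t : ℝ) (w : ℂ) : ℝ≥0∞ := ENNReal.ofReal ((1 - ‖w‖ ^ 2) ^ t)

theorem measurable_diskWeight (t : ℝ) : Measurable (diskWeight t) := by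
  unfold diskWeight; fun_prop

theorem one_sub_norm_sq_pos {w : ℂ} (hw : ‖w‖ < 1) : 0 < 1 - ‖w‖ ^ 2 := by
  nlinarith [norm_nonneg w]

theorem ae_norm_lt_one_diskArea : ∀ᵐ w ∂diskArea, ‖w‖ < 1 := by
  refine Measure.ae_smul_measure ?_ _
  filter_upwards [ae_restrict_mem Metric.isOpen_ball.measurableSet] with w hw
  simpa using hw

theorem diskArea_absolutelyContinuous : diskArea ≪ (volume : Measure ℂ) :=
  (Measure.restrict_le_self.absolutelyContinuous).smul_left _

theorem ae_ne_zero_diskArea : ∀ᵐ w ∂diskArea, w ≠ 0 :=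
  diskArea_absolutelyContinuous.ae_le (Measure.ae_ne volume 0)

theorem setLIntegral_one_sub_rpow {t r : ℝ} (ht : -1 < t) (hr : 0 < r) :
    ∫⁻ ρ in Ioo (1 - r) 1, ENNReal.ofReal ((1 - ρ) ^ t) =
      ENNReal.ofReal (r ^ (t + 1) / (t + 1)) := by
  have hint : IntervalIntegrable (fun ρ : ℝ => (1 - ρ) ^ t) volume (1 - r) 1 := by
    have := (intervalIntegral.intervalIntegrable_rpow' (a := r) (b := 0) ht).comp_sub_left 1
    simpa using this
  have hval : ∫ ρ in (1 - r)..1, (1 - ρ) ^ t = r ^ (t + 1) / (t + 1) := by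
    rw [intervalIntegral.integral_comp_sub_left (fun x => x ^ t) 1, integral_rpow (Or.inl ht)]
    simp [Real.zero_rpow (by linarith : t + 1 ≠ 0)]
  rw [← hval, intervalIntegral.integral_of_le (by linarith), integral_Ioc_eq_integral_Ioo,
    ofReal_integral_eq_lintegral_ofReal]
  · exact ((intervalIntegrable_iff_integrableOn_Ioo_of_le (by linarith)).1 hint)
  · filter_upwards [ae_restrict_mem measurableSet_Ioo] with ρ hρ
    exact Real.rpow_nonneg (by linarith [hρ.2]) _

/-- A point of the disc within `r` of a point of the circle has its argument within `π r` of it. -/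
theorem abs_arg_le_of_norm_sub_one_lt {z : ℂ} {r : ℝ} (hz : ‖z‖ < 1) (hz0 : z ≠ 0)
    (h : ‖z - 1‖ < r) : |z.arg| ≤ Real.pi * r := by
  have hn : 0 < ‖z‖ := norm_pos_iff.2 hz0
  set u : ℂ := z / (‖z‖ : ℂ) with hu
  have hu1 : ‖u‖ = 1 := by simp [hu, hn.ne']
  have h0 : (1 : ℝ) - ‖z‖ < r := by
    have := norm_sub_norm_le (1 : ℂ) z
    rw [norm_one, norm_sub_rev] at this
    linarith
  have h1 : ‖u - z‖ = 1 - ‖z‖ := by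
    have : u - z = u * ((1 - ‖z‖ : ℝ) : ℂ) := by
      rw [hu]; push_cast; field_simp [Complex.ofReal_ne_zero.2 hn.ne']
    rw [this, norm_mul, hu1, Complex.norm_real, Real.norm_of_nonneg (by linarith), one_mul]
  have h2 : ‖u - 1‖ ≤ 2 * r := by
    calc ‖u - 1‖ = ‖(u - z) + (z - 1)‖ := by ring_nf
      _ ≤ ‖u - z‖ + ‖z - 1‖ := norm_add_le _ _
      _ ≤ 2 * r := by linarith
  have h3 := Complex.mul_angle_le_norm_sub hu1 (norm_one (α := ℂ))
  rw [Complex.angle_one_right (by rw [← norm_pos_iff, hu1]; norm_num)] at h3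
  have h4 : u.arg = z.arg := by
    rw [hu, div_eq_inv_mul, ← Complex.ofReal_inv, Complex.arg_real_mul _ (inv_pos.2 hn)]
  rw [h4] at h3
  have hpi := Real.pi_pos
  have : 2 / Real.pi * |z.arg| ≤ 2 * r := h3.trans h2
  rw [div_mul_eq_mul_div, div_le_iff₀ hpi] at this
  linarith

theorem one_sub_sq_rpow_le (t : ℝ) {ρ : ℝ} (h0 : 0 ≤ ρ) (h1 : ρ < 1) :
    (1 - ρ ^ 2) ^ t ≤ 2 ^ |t| * (1 - ρ) ^ t := by
  rw [show 1 - ρ ^ 2 = (1 + ρ) * (1 - ρ) by ring, Real.mul_rpow (by linarith) (by linarith)]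
  refine mul_le_mul_of_nonneg_right ?_ (Real.rpow_nonneg (by linarith) _)
  calc (1 + ρ) ^ t ≤ (1 + ρ) ^ |t| :=
        Real.rpow_le_rpow_of_exponent_le (by linarith) (le_abs_self t)
    _ ≤ 2 ^ |t| := Real.rpow_le_rpow (by linarith) (by linarith) (abs_nonneg t)

theorem measurePreserving_mul_left_diskArea {ξ : ℂ} (hξ : ‖ξ‖ = 1) :
    MeasurePreserving (fun w => ξ * w) diskArea diskArea := by
  have h : MeasurePreserving (rotation ⟨ξ, mem_sphere_zero_iff_norm.2 hξ⟩) volume volume :=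
    LinearIsometryEquiv.measurePreserving _
  have h2 := (h.restrict_preimage (s := Metric.ball 0 1) measurableSet_ball).smul_measure
    (ENNReal.ofReal (Real.pi⁻¹))
  rw [LinearIsometryEquiv.preimage_ball, map_zero] at h2
  exact h2

theorem setLIntegral_diskWeight_ball_rotate (t : ℝ) {ξ : ℂ} (hξ : ‖ξ‖ = 1) (r : ℝ) :
    ∫⁻ w in Metric.ball ξ r, diskWeight t w ∂diskArea =
      ∫⁻ w in Metric.ball 1 r, diskWeight t w ∂diskArea := by
  rw [← (measurePreserving_mul_left_diskArea hξ).setLIntegral_comp_preimage measurableSet_ball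
    (measurable_diskWeight t)]
  congr 1
  · congr 1
    ext w
    have : ξ * w - ξ = ξ * (w - 1) := by ring
    simp [dist_eq_norm, this, hξ]
  · ext w
    simp [diskWeight, hξ]

/-- The weighted area of `{w ∈ 𝔻 : |w - ξ| < r}`, `|ξ| = 1`, is `O(r^(t+2))`. -/
theorem exists_setLIntegral_diskWeight_ball_le {t : ℝ} (ht : -1 < t) :
    ∃ C : ℝ≥0, ∀ ξ : ℂ, ‖ξ‖ = 1 → ∀ r : ℝ, 0 < r →
      ∫⁻ w in Metric.ball ξ r, diskWeight t w ∂diskArea ≤ C * ENNReal.ofReal (r ^ (t + 2)) := by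
  refine ⟨(2 ^ |t| * 2 / (t + 1)).toNNReal, fun ξ hξ r hr => ?_⟩
  have ht1 : 0 < t + 1 := by linarith
  have hpi := Real.pi_pos
  rw [setLIntegral_diskWeight_ball_rotate t hξ, diskArea, Measure.restrict_smul,
    lintegral_smul_measure, Measure.restrict_restrict measurableSet_ball,
    ← lintegral_indicator (measurableSet_ball.inter measurableSet_ball),
    ← Complex.lintegral_comp_polarCoord_symm]
  -- in polar coordinates the region lies in the rectangle `(1 - r, 1) × [-π r, π r]`
  have key : ∀ p ∈ polarCoord.target, ENNReal.ofReal p.1 •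
      (Metric.ball (1 : ℂ) r ∩ Metric.ball 0 1).indicator (diskWeight t) (Complex.polarCoord.symm p)
      ≤ (Ioo (1 - r) 1).indicator (fun ρ => ENNReal.ofReal (2 ^ |t|) *
          ENNReal.ofReal ((1 - ρ) ^ t)) p.1 *
        (Icc (-(Real.pi * r)) (Real.pi * r)).indicator (fun _ => 1) p.2 := by
    rintro ⟨ρ, θ⟩ ⟨hρ, hθ⟩
    simp only [mem_Ioi] at hρ
    by_cases hm : Complex.polarCoord.symm (ρ, θ) ∈ Metric.ball (1 : ℂ) r ∩ Metric.ball 0 1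
    swap
    · rw [indicator_of_notMem hm, smul_zero]; exact bot_le
    have hn : ‖Complex.polarCoord.symm (ρ, θ)‖ = ρ := by
      rw [Complex.norm_polarCoord_symm, abs_of_pos hρ]
    have hρ1 : ρ < 1 := by have := hm.2; rwa [mem_ball_zero_iff, hn] at this
    have hd : ‖Complex.polarCoord.symm (ρ, θ) - 1‖ < r := by
      have := hm.1; rwa [Metric.mem_ball, dist_eq_norm] at this
    have harg : (Complex.polarCoord.symm (ρ, θ)).arg = θ := by
      rw [Complex.polarCoord_symm_apply]
      have := Complex.arg_mul_cos_add_sin_mul_I hρ (θ := θ) ⟨hθ.1, hθ.2.le⟩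
      simpa using this
    have h1 := abs_arg_le_of_norm_sub_one_lt (by rwa [hn])
      (by rw [← norm_pos_iff, hn]; exact hρ) hd
    rw [harg, abs_le] at h1
    have h2 : 1 - r < ρ := by
      have := norm_sub_norm_le (1 : ℂ) (Complex.polarCoord.symm (ρ, θ))
      rw [norm_one, norm_sub_rev, hn] at this
      linarith
    rw [indicator_of_mem hm, indicator_of_mem (show ρ ∈ Ioo (1 - r) 1 from ⟨h2, hρ1⟩),
      indicator_of_mem (show θ ∈ Icc (-(Real.pi * r)) (Real.pi * r) from ⟨h1.1, h1.2⟩), mul_one,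
      diskWeight, hn, smul_eq_mul, ← ENNReal.ofReal_mul (by positivity),
      ← ENNReal.ofReal_mul (by positivity)]
    refine ENNReal.ofReal_le_ofReal ?_
    have h3 : 0 ≤ (1 - ρ ^ 2) ^ t := Real.rpow_nonneg (by nlinarith) _
    nlinarith [one_sub_sq_rpow_le t hρ.le hρ1]
  refine (mul_le_mul_right (setLIntegral_mono' polarCoord.open_target.measurableSet key) _).trans ?_
  refine (mul_le_mul_right (setLIntegral_le_lintegral _ _) _).trans ?_
  rw [Measure.volume_eq_prod, lintegral_prod_mul
    ((Measurable.indicator (by fun_prop) measurableSet_Ioo).aemeasurable)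
    ((measurable_const.indicator measurableSet_Icc).aemeasurable),
    lintegral_indicator measurableSet_Ioo, lintegral_const_mul _ (by fun_prop),
    setLIntegral_one_sub_rpow ht hr, lintegral_indicator measurableSet_Icc, setLIntegral_one,
    Real.volume_Icc]
  rw [← ENNReal.ofReal_mul (by positivity), ← ENNReal.ofReal_mul (by positivity),
    ← ENNReal.ofReal_mul (by positivity), ENNReal.ofNNReal_toNNReal,
    ← ENNReal.ofReal_mul (by positivity)]
  refine ENNReal.ofReal_le_ofReal (le_of_eq ?_)
  rw [show t + 2 = t + 1 + 1 by ring, Real.rpow_add_one hr.ne' (t + 1)]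
  field_simp
  ring

theorem carlesonBox_subset_ball {a b : ℝ} (hab : a < b) :
    carlesonBox a b ⊆ Metric.ball (Complex.exp (a * Complex.I)) (9 * arcLength a b) := by
  rintro z ⟨h1, h2, t, ht, htz⟩
  have hpi := Real.pi_pos
  have hL : b - a = 2 * Real.pi * arcLength a b := by unfold arcLength; field_simp
  have hLpos : 0 < arcLength a b := by unfold arcLength; exact div_pos (by linarith) (by positivity)
  simp only at htz
  have hn : ‖z / (‖z‖ : ℂ)‖ = 1 := by rw [← htz, Complex.norm_exp_ofReal_mul_I]
  have hz0 : z ≠ 0 := by rintro rfl; simp at hn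
  have hz1 : ‖z - z / (‖z‖ : ℂ)‖ = 1 - ‖z‖ := by
    have : z - z / (‖z‖ : ℂ) = -(z / (‖z‖ : ℂ) * ((1 - ‖z‖ : ℝ) : ℂ)) := by
      push_cast; field_simp [Complex.ofReal_ne_zero.2 (norm_pos_iff.2 hz0).ne']; ring
    rw [this, norm_neg, norm_mul, hn, Complex.norm_real, Real.norm_of_nonneg (by linarith), one_mul]
  have hz2 : ‖Complex.exp (t * Complex.I) - Complex.exp (a * Complex.I)‖ ≤ t - a := by
    have : Complex.exp (t * Complex.I) - Complex.exp (a * Complex.I) =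
        Complex.exp (a * Complex.I) * (Complex.exp (Complex.I * (t - a : ℝ)) - 1) := by
      rw [mul_sub, mul_one, ← Complex.exp_add]; push_cast; ring_nf
    rw [this, norm_mul, Complex.norm_exp_ofReal_mul_I, one_mul]
    refine Real.norm_exp_I_mul_ofReal_sub_one_le.trans ?_
    rw [Real.norm_of_nonneg (by linarith [ht.1])]
  rw [Metric.mem_ball, dist_eq_norm]
  calc ‖z - Complex.exp (a * Complex.I)‖
      ≤ ‖z - z / (‖z‖ : ℂ)‖ + ‖z / (‖z‖ : ℂ) - Complex.exp (a * Complex.I)‖ :=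
        norm_sub_le_norm_sub_add_norm_sub _ _ _
    _ ≤ (1 - ‖z‖) + (t - a) := by rw [hz1, ← htz]; gcongr
    _ < 9 * arcLength a b := by nlinarith [ht.2, Real.pi_lt_four, Real.pi_gt_three, Real.pi_lt_d2]

theorem arcLength_symmetric (θ h : ℝ) :
    arcLength (θ - Real.pi * h) (θ + Real.pi * h) = h := by
  have := Real.pi_pos
  unfold arcLength; field_simp; ring

theorem mem_carlesonBox_of_abs_arg_le {ξ z : ℂ} (hξ : ‖ξ‖ = 1) {h : ℝ} (hz : ‖z‖ < 1)
    (hz0 : z ≠ 0) (hzh : 1 - h ≤ ‖z‖) (harg : |(z / ξ).arg| ≤ Real.pi * h) :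
    z ∈ carlesonBox (ξ.arg - Real.pi * h) (ξ.arg + Real.pi * h) := by
  have hξ0 : ξ ≠ 0 := by rw [← norm_pos_iff, hξ]; exact one_pos
  have hn : ‖z / ξ‖ = ‖z‖ := by rw [norm_div, hξ, div_one]
  rw [abs_le] at harg
  refine ⟨by rwa [arcLength_symmetric], hz, ξ.arg + (z / ξ).arg, ⟨by linarith, by linarith⟩, ?_⟩
  have e1 := Complex.norm_mul_exp_arg_mul_I ξ
  have e2 := Complex.norm_mul_exp_arg_mul_I (z / ξ)
  rw [hξ, Complex.ofReal_one, one_mul] at e1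
  rw [hn] at e2
  simp only
  push_cast
  rw [add_mul, Complex.exp_add, e1, eq_div_iff (by simpa using hz0), mul_assoc,
    mul_comm _ (‖z‖ : ℂ), e2]
  field_simp

/-- For measures absolutely continuous with respect to area on the disc, Carleson boxes may be
replaced by discs centred on the unit circle, with no restriction on the radius. -/
theorem isCarlesonMeasure_iff_ball {s : ℝ} (hs : 0 ≤ s) {μ : Measure ℂ} (hμ : μ ≪ diskArea) :
    IsCarlesonMeasure s μ ↔ ∃ C : ℝ≥0, ∀ ξ : ℂ, ‖ξ‖ = 1 → ∀ r : ℝ, 0 < r →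
      μ (Metric.ball ξ r) ≤ C * ENNReal.ofReal (r ^ s) := by
  have hpi := Real.pi_pos
  constructor
  · rintro ⟨C, hC⟩
    refine ⟨C, fun ξ hξ r hr => ?_⟩
    have hm : 0 < min r 1 := lt_min hr one_pos
    have hbox := hC (ξ.arg - Real.pi * min r 1) (ξ.arg + Real.pi * min r 1) (by nlinarith)
      (by nlinarith [min_le_right r 1])
    rw [arcLength_symmetric] at hbox
    refine le_trans (measure_mono_ae ?_) (hbox.trans ?_)
    · filter_upwards [hμ.ae_le ae_norm_lt_one_diskArea, hμ.ae_le ae_ne_zero_diskArea]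
        with z hz hz0 hzr
      have hn : ‖z / ξ‖ = ‖z‖ := by rw [norm_div, hξ, div_one]
      have hξ0 : ξ ≠ 0 := by rw [← norm_pos_iff, hξ]; exact one_pos
      have hzr' : ‖z - ξ‖ < r := by rwa [← dist_eq_norm]
      rcases le_total r 1 with h | h
      · rw [min_eq_left h]
        refine mem_carlesonBox_of_abs_arg_le hξ hz hz0 ?_
          (abs_arg_le_of_norm_sub_one_lt (hn ▸ hz) (div_ne_zero hz0 hξ0) ?_)
        · have := norm_sub_norm_le ξ z
          rw [norm_sub_rev, hξ] at this
          linarith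
        · rwa [div_sub_one hξ0, norm_div, hξ, div_one]
      · -- the box over the whole circle contains the punctured disc
        rw [min_eq_right h]
        exact mem_carlesonBox_of_abs_arg_le hξ hz hz0 (by simp)
          (by simpa using Complex.abs_arg_le_pi _)
    · gcongr
      exact min_le_left _ _
  · rintro ⟨C, hC⟩
    refine ⟨C * ((9 : ℝ) ^ s).toNNReal, fun a b hab _ => ?_⟩
    have hL : 0 < arcLength a b := div_pos (by linarith) (by positivity)
    refine (measure_mono (carlesonBox_subset_ball hab)).trans ((hC _
      (Complex.norm_exp_ofReal_mul_I a) _ (by positivity)).trans (le_of_eq ?_))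
    rw [Real.mul_rpow (by norm_num) hL.le, ENNReal.ofReal_mul (by positivity), ENNReal.coe_mul,
      mul_assoc, ENNReal.ofNNReal_toNNReal]

/-! ### Dyadic sums and the Forelli-Rudin estimate -/

/-- Cauchy-Schwarz for lower integrals. -/
theorem sq_lintegral_mul_le {α : Type*} [MeasurableSpace α] (μ : Measure α) {f g : α → ℝ≥0∞}
    (hf : AEMeasurable f μ) (hg : AEMeasurable g μ) :
    (∫⁻ a, f a * g a ∂μ) ^ 2 ≤ (∫⁻ a, f a ^ 2 ∂μ) * ∫⁻ a, g a ^ 2 ∂μ := by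
  have h := ENNReal.lintegral_mul_le_Lp_mul_Lq μ Real.HolderConjugate.two_two hf hg
  have h2 := pow_le_pow_left' h 2
  simp only [Pi.mul_apply, ENNReal.rpow_two] at h2
  refine h2.trans (le_of_eq ?_)
  rw [mul_pow, ← ENNReal.rpow_natCast, ← ENNReal.rpow_natCast, ← ENNReal.rpow_mul,
    ← ENNReal.rpow_mul]
  norm_num

theorem ENNReal.add_sq_le_four_mul (a b : ℝ≥0∞) : (a + b) ^ 2 ≤ 4 * (a ^ 2 + b ^ 2) := by
  wlog h : a ≤ b generalizing a b
  · rw [add_comm a b, add_comm (a ^ 2)]; exact this b a (le_of_not_ge h)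
  calc (a + b) ^ 2 ≤ (b + b) ^ 2 := by gcongr
    _ = 4 * b ^ 2 := by ring
    _ ≤ 4 * (a ^ 2 + b ^ 2) := by gcongr; exact le_add_self

/-- A growth bound `μ (ball ξ r) ≤ A r^σ` controls the integrals of negative powers `q > σ` of the
distance to `ξ`, truncated at scale `δ`: sum over dyadic discs. -/
theorem exists_lintegral_max_rpow_le {σ q : ℝ} (hq : 0 ≤ q) (hσq : σ < q) :
    ∃ C : ℝ≥0, ∀ (μ : Measure ℂ) (A : ℝ≥0∞) (ξ : ℂ) (δ : ℝ), 0 < δ →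
      (∀ r : ℝ, 0 < r → μ (Metric.ball ξ r) ≤ A * ENNReal.ofReal (r ^ σ)) →
      ∫⁻ w, ENNReal.ofReal ((max ‖w - ξ‖ δ) ^ (-q)) ∂μ ≤
        C * A * ENNReal.ofReal (δ ^ (σ - q)) := by
  have hsum : Summable fun n : ℕ => (2 : ℝ) ^ q * ((2 : ℝ) ^ (σ - q)) ^ n :=
    (summable_geometric_of_lt_one (by positivity)
      (Real.rpow_lt_one_of_one_lt_of_neg one_lt_two (by linarith))).mul_left _
  refine ⟨(∑' n : ℕ, (2 : ℝ) ^ q * ((2 : ℝ) ^ (σ - q)) ^ n).toNNReal, fun μ A ξ δ hδ hμ => ?_⟩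
  have hpt : ∀ w : ℂ, ENNReal.ofReal ((max ‖w - ξ‖ δ) ^ (-q)) ≤
      ∑' n : ℕ, (Metric.ball ξ (2 ^ n * δ)).indicator
        (fun _ => ENNReal.ofReal ((2 ^ n * δ / 2) ^ (-q))) w := by
    intro w
    have hex : ∃ n : ℕ, ‖w - ξ‖ < 2 ^ n * δ := by
      obtain ⟨n, hn⟩ := pow_unbounded_of_one_lt (‖w - ξ‖ / δ) one_lt_two
      exact ⟨n, (div_lt_iff₀ hδ).1 hn⟩
    classical
    have hn := Nat.find_spec hex
    have hmin := fun m => Nat.find_min hex (m := m)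
    set n := Nat.find hex
    -- the term of the smallest dyadic disc containing `w` suffices
    refine le_trans ?_ (ENNReal.le_tsum n)
    rw [indicator_of_mem (by rwa [Metric.mem_ball, dist_eq_norm])]
    refine ENNReal.ofReal_le_ofReal
      (Real.rpow_le_rpow_of_nonpos (by positivity) ?_ (by linarith))
    rcases Nat.eq_zero_or_pos n with h0 | h0
    · rw [h0]; exact le_max_of_le_right (by linarith)
    · refine le_max_of_le_left ?_
      have := not_lt.1 (hmin (n - 1) (by omega))
      obtain ⟨m, hm⟩ : ∃ m, n = m + 1 := ⟨n - 1, by omega⟩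
      rw [hm, Nat.add_sub_cancel] at this
      rw [hm, pow_succ]; linarith
  refine (lintegral_mono hpt).trans ?_
  rw [lintegral_tsum fun n => (measurable_const.indicator measurableSet_ball).aemeasurable]
  simp_rw [lintegral_indicator_const measurableSet_ball]
  calc ∑' n : ℕ, ENNReal.ofReal ((2 ^ n * δ / 2) ^ (-q)) * μ (Metric.ball ξ (2 ^ n * δ))
      ≤ ∑' n : ℕ, ENNReal.ofReal ((2 ^ n * δ / 2) ^ (-q)) *
          (A * ENNReal.ofReal ((2 ^ n * δ) ^ σ)) := by
        gcongr with n
        exact hμ _ (by positivity)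
    _ = ∑' n : ℕ, A * ENNReal.ofReal (δ ^ (σ - q)) *
          ENNReal.ofReal ((2 : ℝ) ^ q * ((2 : ℝ) ^ (σ - q)) ^ n) := by
        congr 1 with n
        rw [mul_left_comm, ← ENNReal.ofReal_mul (by positivity), mul_assoc,
          ← ENNReal.ofReal_mul (by positivity)]
        congr 2
        rw [Real.div_rpow (by positivity) two_pos.le, Real.mul_rpow (by positivity) hδ.le,
          Real.mul_rpow (by positivity) hδ.le, Real.rpow_pow_comm two_pos.le, Real.rpow_sub hδ,
          Real.rpow_sub (by positivity), Real.rpow_neg two_pos.le, Real.rpow_neg hδ.le,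
          Real.rpow_neg (by positivity)]
        field_simp
    _ = _ := by
        rw [ENNReal.tsum_mul_left, ← ENNReal.ofReal_tsum_of_nonneg (fun n => by positivity) hsum,
          ENNReal.ofNNReal_toNNReal]
        ring

/-- This follows from `|1 - w̄ z|² - |w - z|² = (1 - |z|²) (1 - |w|²)`. -/
theorem norm_sub_le_norm_one_sub_conj_mul {z w : ℂ} (hz : ‖z‖ < 1) (hw : ‖w‖ < 1) :
    ‖w - z‖ ≤ ‖1 - conj w * z‖ := by
  have h : ‖1 - conj w * z‖ ^ 2 - ‖w - z‖ ^ 2 = (1 - ‖z‖ ^ 2) * (1 - ‖w‖ ^ 2) := by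
    simp only [Complex.sq_norm, Complex.normSq_apply, Complex.sub_re, Complex.sub_im,
      Complex.mul_re, Complex.mul_im, Complex.conj_re, Complex.conj_im, Complex.one_re,
      Complex.one_im]
    ring
  refine abs_le_of_sq_le_sq' ?_ (norm_nonneg _) |>.2
  nlinarith [mul_pos (one_sub_norm_sq_pos hz) (one_sub_norm_sq_pos hw)]

theorem one_sub_norm_le_norm_one_sub_conj_mul {z w : ℂ} (hw : ‖w‖ < 1) :
    1 - ‖z‖ ≤ ‖1 - conj w * z‖ := by
  have := norm_sub_norm_le (1 : ℂ) (conj w * z)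
  rw [norm_one, norm_mul, RCLike.norm_conj] at this
  nlinarith [norm_nonneg z]

theorem exists_norm_eq_one_norm_sub_eq (z : ℂ) : ∃ ξ : ℂ, ‖ξ‖ = 1 ∧ ‖z - ξ‖ = |1 - ‖z‖| := by
  rcases eq_or_ne z 0 with rfl | hz
  · exact ⟨1, by simp⟩
  · have hn := norm_pos_iff.2 hz
    refine ⟨z / (‖z‖ : ℂ), by simp [hn.ne'], ?_⟩
    have : z - z / (‖z‖ : ℂ) = -(z / (‖z‖ : ℂ) * ((1 - ‖z‖ : ℝ) : ℂ)) := by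
      push_cast; field_simp [Complex.ofReal_ne_zero.2 hn.ne']; ring
    rw [this, norm_neg, norm_mul, Complex.norm_real, norm_div, Complex.norm_real, norm_norm,
      div_self hn.ne', one_mul, Real.norm_eq_abs]

/-- The Forelli-Rudin estimate. With `ξ` the point of the circle nearest to `z` and `δ = 1 - |z|`,
`|1 - w̄ z|` is at least half of `max (|w - ξ|, δ)`, and the dyadic bound applies. -/
theorem exists_lintegral_diskWeight_mul_le {t c : ℝ} (ht : -1 < t) (hc : 0 < c) :
    ∃ C : ℝ≥0, ∀ z : ℂ, ‖z‖ < 1 →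
      ∫⁻ w, diskWeight t w * ENNReal.ofReal (‖1 - conj w * z‖ ^ (-(2 + t + c))) ∂diskArea ≤
        C * diskWeight (-c) z := by
  obtain ⟨A, hA⟩ := exists_setLIntegral_diskWeight_ball_le ht
  obtain ⟨B, hB⟩ := exists_lintegral_max_rpow_le (σ := t + 2) (q := 2 + t + c) (by linarith)
    (by linarith)
  refine ⟨((2 : ℝ) ^ (2 + t + c)).toNNReal * (B * A) * ((2 : ℝ) ^ c).toNNReal, fun z hz => ?_⟩
  obtain ⟨ξ, hξ, hzξ⟩ := exists_norm_eq_one_norm_sub_eq z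
  rw [abs_of_pos (by linarith)] at hzξ
  have hδ : 0 < 1 - ‖z‖ := by linarith
  have h1 := hB (diskArea.withDensity (diskWeight t)) A ξ (1 - ‖z‖) hδ fun r hr => by
    rw [withDensity_apply _ measurableSet_ball]; exact hA ξ hξ r hr
  rw [lintegral_withDensity_eq_lintegral_mul _ (measurable_diskWeight t) (by fun_prop)] at h1
  calc _ ≤ ∫⁻ w, ENNReal.ofReal ((2 : ℝ) ^ (2 + t + c)) * (diskWeight t w *
          ENNReal.ofReal ((max ‖w - ξ‖ (1 - ‖z‖)) ^ (-(2 + t + c)))) ∂diskArea := by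
        refine lintegral_mono_ae ?_
        filter_upwards [ae_norm_lt_one_diskArea] with w hw
        rw [mul_left_comm, ← ENNReal.ofReal_mul (by positivity)]
        refine mul_le_mul_right (ENNReal.ofReal_le_ofReal ?_) _
        have hm : max ‖w - ξ‖ (1 - ‖z‖) / 2 ≤ ‖1 - conj w * z‖ := by
          rw [div_le_iff₀ two_pos, max_le_iff]
          have h3 := norm_sub_le_norm_one_sub_conj_mul hz hw
          have h4 := one_sub_norm_le_norm_one_sub_conj_mul (z := z) hw
          exact ⟨by linarith [norm_sub_le_norm_sub_add_norm_sub w z ξ], by linarith⟩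
        have hp : 0 < max ‖w - ξ‖ (1 - ‖z‖) := lt_max_of_lt_right hδ
        refine (Real.rpow_le_rpow_of_nonpos (by positivity) hm (by linarith)).trans (le_of_eq ?_)
        rw [Real.div_rpow hp.le two_pos.le, Real.rpow_neg two_pos.le, div_inv_eq_mul, mul_comm]
    _ ≤ ENNReal.ofReal ((2 : ℝ) ^ (2 + t + c)) *
          (B * A * ENNReal.ofReal ((1 - ‖z‖) ^ (t + 2 - (2 + t + c)))) := by
        rw [lintegral_const_mul']
        · gcongr; exact h1
        · exact ENNReal.ofReal_ne_top
    _ ≤ ENNReal.ofReal ((2 : ℝ) ^ (2 + t + c)) *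
          (B * A * (ENNReal.ofReal ((2 : ℝ) ^ c) * diskWeight (-c) z)) := by
        gcongr
        rw [diskWeight, ← ENNReal.ofReal_mul (by positivity)]
        refine ENNReal.ofReal_le_ofReal ?_
        have : (1 - ‖z‖ ^ 2) / 2 ≤ 1 - ‖z‖ := by nlinarith [norm_nonneg z]
        have hp := one_sub_norm_sq_pos hz
        rw [show t + 2 - (2 + t + c) = -c by ring]
        refine (Real.rpow_le_rpow_of_nonpos (by positivity) this (by linarith)).trans (le_of_eq ?_)
        rw [Real.div_rpow hp.le two_pos.le, Real.rpow_neg two_pos.le, div_inv_eq_mul, mul_comm]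
    _ = _ := by
        simp only [ENNReal.coe_mul, ENNReal.ofNNReal_toNNReal]; ring

/-! ### Boundedness on `L²` of the Bergman-type operators -/

instance isFiniteMeasure_diskArea : IsFiniteMeasure diskArea := by
  refine ⟨?_⟩
  rw [diskArea, Measure.smul_apply, Measure.restrict_apply_univ, smul_eq_mul]
  exact ENNReal.mul_lt_top ENNReal.ofReal_lt_top measure_ball_lt_top

/-- The kernel `(1 - |z|²)^x (1 - |w|²)^y / |1 - w̄ z|^(2+x+y)`. -/
noncomputable def bergmanKernel (x y : ℝ) (z w : ℂ) : ℝ≥0∞ :=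
  diskWeight x z * (diskWeight y w * ENNReal.ofReal (‖1 - conj w * z‖ ^ (-(2 + x + y))))

theorem measurable_bergmanKernel (x y : ℝ) :
    Measurable (Function.uncurry (bergmanKernel x y)) := by
  have h1 : Measurable fun p : ℂ × ℂ => ‖1 - conj p.2 * p.1‖ :=
    (continuous_const.sub ((Complex.continuous_conj.comp continuous_snd).mul
      continuous_fst)).norm.measurable
  exact ((measurable_diskWeight x).comp measurable_fst).mul
    (((measurable_diskWeight y).comp measurable_snd).mul (h1.pow_const _).ennreal_ofReal)

theorem measurable_bergmanKernel_right (x y : ℝ) (z : ℂ) : Measurable (bergmanKernel x y z) :=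
  (measurable_bergmanKernel x y).of_uncurry_left

theorem bergmanKernel_symm (x y : ℝ) (z w : ℂ) : bergmanKernel x y z w = bergmanKernel y x w z := by
  have : ‖1 - conj w * z‖ = ‖1 - conj z * w‖ := by
    rw [← RCLike.norm_conj (1 - conj w * z)]; simp [mul_comm]
  unfold bergmanKernel
  rw [this, show 2 + x + y = 2 + y + x by ring]; ring

theorem diskWeight_mul_diskWeight (s t : ℝ) {w : ℂ} (hw : ‖w‖ < 1) :
    diskWeight s w * diskWeight t w = diskWeight (s + t) w := by
  have h := one_sub_norm_sq_pos hw
  rw [diskWeight, diskWeight, diskWeight, ← ENNReal.ofReal_mul (by positivity), Real.rpow_add h]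

theorem diskWeight_sq (t : ℝ) {w : ℂ} (hw : ‖w‖ < 1) :
    diskWeight t w ^ 2 = diskWeight (2 * t) w := by
  rw [sq, diskWeight_mul_diskWeight t t hw, two_mul]

theorem diskWeight_ne_top (t : ℝ) (w : ℂ) : diskWeight t w ≠ ∞ := ENNReal.ofReal_ne_top

theorem diskWeight_zero (w : ℂ) : diskWeight 0 w = 1 := by simp [diskWeight]

/-- `(1 - |w|²)^(-1/2)` is a Schur test function for the kernel. -/
theorem exists_lintegral_bergmanKernel_mul_le {x y : ℝ} (hx : -1 / 2 < x) (hy : -1 / 2 < y) :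
    ∃ C : ℝ≥0, ∀ z : ℂ, ‖z‖ < 1 →
      ∫⁻ w, bergmanKernel x y z w * diskWeight (-1 / 2) w ∂diskArea ≤
        C * diskWeight (-1 / 2) z := by
  obtain ⟨C, hC⟩ := exists_lintegral_diskWeight_mul_le (t := y - 1 / 2) (c := x + 1 / 2)
    (by linarith) (by linarith)
  refine ⟨C, fun z hz => ?_⟩
  calc _ = ∫⁻ w, diskWeight x z * (diskWeight (y - 1 / 2) w *
          ENNReal.ofReal (‖1 - conj w * z‖ ^ (-(2 + (y - 1 / 2) + (x + 1 / 2))))) ∂diskArea := by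
        refine lintegral_congr_ae ?_
        filter_upwards [ae_norm_lt_one_diskArea] with w hw
        rw [bergmanKernel, show y - 1 / 2 = y + -1 / 2 by ring, ← diskWeight_mul_diskWeight y _ hw,
          show 2 + (y + -1 / 2) + (x + 1 / 2) = 2 + x + y by ring]
        ring
    _ ≤ diskWeight x z * (C * diskWeight (-(x + 1 / 2)) z) := by
        rw [lintegral_const_mul' _ _ (diskWeight_ne_top _ _)]
        gcongr
        exact hC z hz
    _ = _ := by
        rw [mul_left_comm, diskWeight_mul_diskWeight _ _ hz]; ring_nf

/-- Schur's test: the kernel is bounded on `L²(dA)` for `x, y > -1/2`. -/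
theorem exists_lintegral_sq_bergmanKernel_le {x y : ℝ} (hx : -1 / 2 < x) (hy : -1 / 2 < y) :
    ∃ C : ℝ≥0, ∀ u : ℂ → ℝ≥0∞, Measurable u →
      ∫⁻ z, (∫⁻ w, bergmanKernel x y z w * u w ∂diskArea) ^ 2 ∂diskArea ≤
        C * ∫⁻ w, u w ^ 2 ∂diskArea := by
  obtain ⟨C₁, h₁⟩ := exists_lintegral_bergmanKernel_mul_le hx hy
  obtain ⟨C₂, h₂⟩ := exists_lintegral_bergmanKernel_mul_le hy hx
  refine ⟨C₁ * C₂, fun u hu => ?_⟩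
  have hK := measurable_bergmanKernel_right x y
  have hW := measurable_diskWeight
  have hstep : ∀ z : ℂ, ‖z‖ < 1 → (∫⁻ w, bergmanKernel x y z w * u w ∂diskArea) ^ 2 ≤
      C₁ * ∫⁻ w, diskWeight (-1 / 2) z * (bergmanKernel x y z w *
        (u w ^ 2 * diskWeight (1 / 2) w)) ∂diskArea := by
    intro z hz
    -- Cauchy-Schwarz for the measure `k(z, ·) dA`, with `u` split as `d^(-1/4) * (u d^(1/4))`
    have hcs := sq_lintegral_mul_le (diskArea.withDensity (bergmanKernel x y z))
      (hW (-1 / 4)).aemeasurable (hu.mul (hW (1 / 4))).aemeasurable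
    simp only [Pi.mul_apply] at hcs
    rw [lintegral_withDensity_eq_lintegral_mul _ (hK z) (by fun_prop),
      lintegral_withDensity_eq_lintegral_mul _ (hK z) (by fun_prop),
      lintegral_withDensity_eq_lintegral_mul _ (hK z) (by fun_prop)] at hcs
    simp only [Pi.mul_apply] at hcs
    have e1 : ∫⁻ w, bergmanKernel x y z w * u w ∂diskArea = ∫⁻ w, bergmanKernel x y z w *
        (diskWeight (-1 / 4) w * (u w * diskWeight (1 / 4) w)) ∂diskArea := by
      refine lintegral_congr_ae ?_
      filter_upwards [ae_norm_lt_one_diskArea] with w hw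
      rw [mul_left_comm (diskWeight _ _), diskWeight_mul_diskWeight _ _ hw]
      norm_num [diskWeight_zero]
    have e2 : ∫⁻ w, bergmanKernel x y z w * diskWeight (-1 / 4) w ^ 2 ∂diskArea =
        ∫⁻ w, bergmanKernel x y z w * diskWeight (-1 / 2) w ∂diskArea := by
      refine lintegral_congr_ae ?_
      filter_upwards [ae_norm_lt_one_diskArea] with w hw
      rw [diskWeight_sq _ hw]; norm_num
    have e3 : ∫⁻ w, bergmanKernel x y z w * (u w * diskWeight (1 / 4) w) ^ 2 ∂diskArea =
        ∫⁻ w, bergmanKernel x y z w * (u w ^ 2 * diskWeight (1 / 2) w) ∂diskArea := by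
      refine lintegral_congr_ae ?_
      filter_upwards [ae_norm_lt_one_diskArea] with w hw
      rw [mul_pow, diskWeight_sq _ hw]; norm_num
    rw [e1, lintegral_const_mul' _ _ (diskWeight_ne_top _ _), ← mul_assoc]
    refine hcs.trans ?_
    rw [e2, e3]
    exact mul_le_mul_left (h₁ z hz) _
  calc _ ≤ ∫⁻ z, C₁ * ∫⁻ w, diskWeight (-1 / 2) z * (bergmanKernel x y z w *
        (u w ^ 2 * diskWeight (1 / 2) w)) ∂diskArea ∂diskArea := by
        refine lintegral_mono_ae ?_
        filter_upwards [ae_norm_lt_one_diskArea] with z hz using hstep z hz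
    _ = C₁ * ∫⁻ w, ∫⁻ z, diskWeight (-1 / 2) z * (bergmanKernel x y z w *
        (u w ^ 2 * diskWeight (1 / 2) w)) ∂diskArea ∂diskArea := by
        rw [lintegral_const_mul' _ _ ENNReal.coe_ne_top, lintegral_lintegral_swap]
        have := measurable_bergmanKernel x y
        unfold Function.uncurry at this ⊢
        exact (((hW _).comp measurable_fst).mul (this.mul
          ((by fun_prop : Measurable fun w => u w ^ 2 * diskWeight (1 / 2) w).comp
            measurable_snd))).aemeasurable
    _ ≤ C₁ * ∫⁻ w, C₂ * u w ^ 2 ∂diskArea := by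
        gcongr C₁ * ?_
        refine lintegral_mono_ae ?_
        filter_upwards [ae_norm_lt_one_diskArea] with w hw
        calc _ = ∫⁻ z, (bergmanKernel y x w z * diskWeight (-1 / 2) z) *
              (u w ^ 2 * diskWeight (1 / 2) w) ∂diskArea := by
              congr 1 with z
              rw [bergmanKernel_symm]; ring
          _ ≤ (C₂ * diskWeight (-1 / 2) w) * (u w ^ 2 * diskWeight (1 / 2) w) := by
              rw [lintegral_mul_const]
              · gcongr; exact h₂ w hw
              · exact (measurable_bergmanKernel_right y x w).mul (hW _)
          _ = C₂ * u w ^ 2 * (diskWeight (-1 / 2) w * diskWeight (1 / 2) w) := by ring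
          _ = C₂ * u w ^ 2 := by
              rw [diskWeight_mul_diskWeight _ _ hw]; norm_num [diskWeight_zero]
    _ = _ := by
        rw [lintegral_const_mul' _ _ ENNReal.coe_ne_top, ENNReal.coe_mul, mul_assoc]

/-! ### The Bergman-type operators preserve the Carleson condition -/

/-- If `u² dA` has growth `r^s` at `ξ`, the mass `∫ u (1 - |w|²)^y dA` of the discs around `ξ` is
controlled by Cauchy-Schwarz. -/
theorem exists_setLIntegral_mul_diskWeight_le {s y : ℝ} (hy : -1 / 2 < y) :
    ∃ C : ℝ≥0, ∀ (u : ℂ → ℝ≥0∞) (A : ℝ≥0), Measurable u →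
      ∀ ξ : ℂ, ‖ξ‖ = 1 → ∀ r : ℝ, 0 < r →
      ∫⁻ w in Metric.ball ξ r, u w ^ 2 ∂diskArea ≤ A ^ 2 * ENNReal.ofReal (r ^ s) →
      ∫⁻ w in Metric.ball ξ r, u w * diskWeight y w ∂diskArea ≤
        C * A * ENNReal.ofReal (r ^ (s / 2 + 1 + y)) := by
  obtain ⟨B, hB⟩ := exists_setLIntegral_diskWeight_ball_le (t := 2 * y) (by linarith)
  refine ⟨NNReal.sqrt B, fun u A hu ξ hξ r hr hA => ?_⟩
  have hcs := sq_lintegral_mul_le (diskArea.restrict (Metric.ball ξ r)) hu.aemeasurable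
    (measurable_diskWeight y).aemeasurable
  have e : ∫⁻ w in Metric.ball ξ r, diskWeight y w ^ 2 ∂diskArea =
      ∫⁻ w in Metric.ball ξ r, diskWeight (2 * y) w ∂diskArea := by
    refine lintegral_congr_ae ?_
    filter_upwards [ae_restrict_of_ae ae_norm_lt_one_diskArea] with w hw using diskWeight_sq y hw
  rw [e] at hcs
  refine (ENNReal.pow_le_pow_left_iff two_ne_zero).1 (hcs.trans ((mul_le_mul' hA (hB ξ hξ r hr)).trans
    (le_of_eq ?_)))
  have h1 : (r ^ s) * r ^ (2 * y + 2) = (r ^ (s / 2 + 1 + y)) ^ 2 := by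
    rw [← Real.rpow_add hr, ← Real.rpow_mul_natCast hr.le]; congr 1; push_cast; ring
  have h2 : (B : ℝ≥0∞) = (NNReal.sqrt B : ℝ≥0∞) ^ 2 := by
    rw [← ENNReal.coe_pow, NNReal.sq_sqrt]
  calc (A : ℝ≥0∞) ^ 2 * ENNReal.ofReal (r ^ s) * (B * ENNReal.ofReal (r ^ (2 * y + 2)))
      = A ^ 2 * B * (ENNReal.ofReal (r ^ s) * ENNReal.ofReal (r ^ (2 * y + 2))) := by ring
    _ = _ := by
        rw [← ENNReal.ofReal_mul (by positivity), h1, ENNReal.ofReal_pow (by positivity), h2]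
        ring

/-- `u² dA` is an `s`-Carleson measure, tested on discs centred on the unit circle. -/
def IsSqCarleson (s : ℝ) (u : ℂ → ℝ≥0∞) : Prop :=
  ∃ C : ℝ≥0, ∀ ξ : ℂ, ‖ξ‖ = 1 → ∀ r : ℝ, 0 < r →
    ∫⁻ w in Metric.ball ξ r, u w ^ 2 ∂diskArea ≤ C * ENNReal.ofReal (r ^ s)

/-- The kernel operator preserves the Carleson condition. Near `ξ` this is the `L²` bound; the
part of `u` away from `ξ` is estimated by its decay on dyadic discs, which is summable for
`s < 2 + 2x`. -/
theorem IsSqCarleson.lintegral_bergmanKernel {s x y : ℝ} (hx : -1 / 2 < x) (hy : -1 / 2 < y)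
    (hs : s < 2 + 2 * x) {u : ℂ → ℝ≥0∞} (hu : Measurable u) (hC : IsSqCarleson s u) :
    IsSqCarleson s fun z => ∫⁻ w, bergmanKernel x y z w * u w ∂diskArea := by
  obtain ⟨C, hC⟩ := hC
  obtain ⟨D, hD⟩ := exists_lintegral_sq_bergmanKernel_le hx hy
  obtain ⟨E, hE⟩ := exists_setLIntegral_mul_diskWeight_le (s := s) hy
  obtain ⟨F, hF⟩ := exists_lintegral_max_rpow_le (σ := s / 2 + 1 + y) (q := 2 + x + y)
    (by linarith) (by linarith)
  obtain ⟨G, hG⟩ := exists_setLIntegral_diskWeight_ball_le (t := 2 * x) (by linarith)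
  set A := NNReal.sqrt C
  have hA : (C : ℝ≥0∞) = (A : ℝ≥0∞) ^ 2 := by rw [← ENNReal.coe_pow, NNReal.sq_sqrt]
  set H : ℝ≥0 := ((2 : ℝ) ^ (2 + x + y)).toNNReal
  refine ⟨4 * (D * C * ((2 : ℝ) ^ s).toNNReal + G * (H * (F * (E * A))) ^ 2), fun ξ hξ r hr => ?_⟩
  set S := Metric.ball ξ (2 * r)
  have hS : MeasurableSet S := measurableSet_ball
  have hnear : ∫⁻ z in Metric.ball ξ r,
      (∫⁻ w, bergmanKernel x y z w * S.indicator u w ∂diskArea) ^ 2 ∂diskArea ≤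
        D * C * ((2 : ℝ) ^ s).toNNReal * ENNReal.ofReal (r ^ s) := by
    refine (setLIntegral_le_lintegral _ _).trans ((hD _ (hu.indicator hS)).trans ?_)
    have : ∫⁻ w, S.indicator u w ^ 2 ∂diskArea = ∫⁻ w in S, u w ^ 2 ∂diskArea := by
      rw [← lintegral_indicator hS]
      congr 1 with w
      by_cases hw : w ∈ S <;> simp [hw]
    rw [this, mul_assoc, mul_assoc]
    gcongr
    refine (hC ξ hξ (2 * r) (by positivity)).trans (le_of_eq ?_)
    rw [Real.mul_rpow two_pos.le hr.le, ENNReal.ofReal_mul (by positivity),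
      ENNReal.ofNNReal_toNNReal]
  have hfar_pt : ∀ z ∈ Metric.ball ξ r, ‖z‖ < 1 →
      ∫⁻ w, bergmanKernel x y z w * Sᶜ.indicator u w ∂diskArea ≤
        diskWeight x z * (H * (F * (E * A) * ENNReal.ofReal (r ^ (s / 2 - 1 - x)))) := by
    intro z hz hz1
    have h1 := hF (diskArea.withDensity (u * diskWeight y)) (E * A) ξ r hr
      fun ρ hρ => by
        rw [withDensity_apply _ measurableSet_ball]
        exact hE u A hu ξ hξ ρ hρ (hA ▸ hC ξ hξ ρ hρ)
    rw [lintegral_withDensity_eq_lintegral_mul _ (hu.mul (measurable_diskWeight y)) (by fun_prop),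
      show s / 2 + 1 + y - (2 + x + y) = s / 2 - 1 - x by ring] at h1
    calc _ ≤ ∫⁻ w, diskWeight x z * (H * (u w * diskWeight y w *
            ENNReal.ofReal ((max ‖w - ξ‖ r) ^ (-(2 + x + y))))) ∂diskArea := by
          refine lintegral_mono_ae ?_
          filter_upwards [ae_norm_lt_one_diskArea] with w hw
          by_cases hwS : w ∈ S
          · simp [hwS]
          rw [indicator_of_mem (show w ∈ Sᶜ from hwS), bergmanKernel]
          have hw2 : 2 * r ≤ ‖w - ξ‖ := by
            simpa [S, Metric.mem_ball, dist_eq_norm] using hwS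
          have hz2 : ‖z - ξ‖ < r := by rwa [Metric.mem_ball, dist_eq_norm] at hz
          have hm : max ‖w - ξ‖ r / 2 ≤ ‖1 - conj w * z‖ := by
            have h3 := norm_sub_le_norm_one_sub_conj_mul hz1 hw
            have h4 := norm_sub_le_norm_sub_add_norm_sub w z ξ
            rw [div_le_iff₀ two_pos, max_le_iff]
            exact ⟨by linarith, by linarith⟩
          have hp : 0 < max ‖w - ξ‖ r := lt_max_of_lt_right hr
          have h5 : ENNReal.ofReal (‖1 - conj w * z‖ ^ (-(2 + x + y))) ≤
              H * ENNReal.ofReal ((max ‖w - ξ‖ r) ^ (-(2 + x + y))) := by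
            rw [ENNReal.ofNNReal_toNNReal, ← ENNReal.ofReal_mul (by positivity)]
            refine ENNReal.ofReal_le_ofReal ((Real.rpow_le_rpow_of_nonpos (by positivity) hm
              (by linarith)).trans (le_of_eq ?_))
            rw [Real.div_rpow hp.le two_pos.le, Real.rpow_neg two_pos.le, div_inv_eq_mul, mul_comm]
          calc _ ≤ diskWeight x z * (diskWeight y w *
                (H * ENNReal.ofReal ((max ‖w - ξ‖ r) ^ (-(2 + x + y))))) * u w := by gcongr
            _ = _ := by ring
      _ ≤ _ := by
          rw [lintegral_const_mul' _ _ (diskWeight_ne_top _ _),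
            lintegral_const_mul' _ _ ENNReal.coe_ne_top]
          gcongr
          exact h1
  have hfar : ∫⁻ z in Metric.ball ξ r,
      (∫⁻ w, bergmanKernel x y z w * Sᶜ.indicator u w ∂diskArea) ^ 2 ∂diskArea ≤
        G * (H * (F * (E * A))) ^ 2 * ENNReal.ofReal (r ^ s) := by
    have e : ∀ W : ℝ≥0∞, (W * (H * (F * (E * A) * ENNReal.ofReal (r ^ (s / 2 - 1 - x))))) ^ 2 =
        W ^ 2 * ((H * (F * (E * A))) ^ 2 * ENNReal.ofReal (r ^ (s - 2 - 2 * x))) := by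
      intro W
      rw [show r ^ (s - 2 - 2 * x) = (r ^ (s / 2 - 1 - x)) ^ 2 by
        rw [← Real.rpow_mul_natCast hr.le]; congr 1; push_cast; ring,
        ENNReal.ofReal_pow (by positivity)]
      ring
    calc _ ≤ ∫⁻ z in Metric.ball ξ r, diskWeight (2 * x) z *
            ((H * (F * (E * A))) ^ 2 * ENNReal.ofReal (r ^ (s - 2 - 2 * x))) ∂diskArea := by
          refine lintegral_mono_ae ?_
          filter_upwards [ae_restrict_of_ae ae_norm_lt_one_diskArea,
            ae_restrict_mem measurableSet_ball] with z hz hzξ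
          rw [← diskWeight_sq x hz, ← e]
          exact pow_le_pow_left' (hfar_pt z hzξ hz) 2
      _ ≤ G * ENNReal.ofReal (r ^ (2 * x + 2)) *
            ((H * (F * (E * A))) ^ 2 * ENNReal.ofReal (r ^ (s - 2 - 2 * x))) := by
          rw [lintegral_mul_const _ (measurable_diskWeight _)]
          gcongr
          exact hG ξ hξ r hr
      _ = G * (H * (F * (E * A))) ^ 2 * (ENNReal.ofReal (r ^ (2 * x + 2)) *
            ENNReal.ofReal (r ^ (s - 2 - 2 * x))) := by ring
      _ = _ := by
          rw [← ENNReal.ofReal_mul (by positivity), ← Real.rpow_add hr]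
          congr 3; ring
  calc _ ≤ ∫⁻ z in Metric.ball ξ r,
        4 * ((∫⁻ w, bergmanKernel x y z w * S.indicator u w ∂diskArea) ^ 2 +
          (∫⁻ w, bergmanKernel x y z w * Sᶜ.indicator u w ∂diskArea) ^ 2) ∂diskArea := by
        refine lintegral_mono fun z => ?_
        have : ∫⁻ w, bergmanKernel x y z w * u w ∂diskArea =
            ∫⁻ w, bergmanKernel x y z w * S.indicator u w ∂diskArea +
            ∫⁻ w, bergmanKernel x y z w * Sᶜ.indicator u w ∂diskArea := by
          rw [← lintegral_add_left (f := fun w => bergmanKernel x y z w * S.indicator u w)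
            ((measurable_bergmanKernel_right x y z).mul (hu.indicator hS))]
          congr 1 with w
          rw [← mul_add]
          congr 1
          by_cases hw : w ∈ S <;> simp [hw]
        simp only [this]
        exact ENNReal.add_sq_le_four_mul _ _
    _ ≤ 4 * (D * C * ((2 : ℝ) ^ s).toNNReal * ENNReal.ofReal (r ^ s) +
          G * (H * (F * (E * A))) ^ 2 * ENNReal.ofReal (r ^ s)) := by
        rw [lintegral_const_mul' _ _ (by norm_num), lintegral_add_left]
        · gcongr
        · refine Measurable.pow_const ?_ 2
          exact ((measurable_bergmanKernel x y).mul
            ((hu.indicator hS).comp measurable_snd)).lintegral_prod_right'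
    _ = _ := by push_cast; ring

/-! ### Power series and radial moments -/

/-- The Taylor coefficients `a (a+1) ⋯ (a+n-1) / n!` of `(1 - ζ)^(-a)`. -/
noncomputable def negBinomCoeff (a : ℝ) (n : ℕ) : ℝ := ∏ k ∈ Finset.range n, (a + k) / (k + 1)

theorem negBinomCoeff_nonneg {a : ℝ} (ha : 0 < a) (n : ℕ) : 0 ≤ negBinomCoeff a n :=
  Finset.prod_nonneg fun _ _ => by positivity

theorem negBinomCoeff_eq_choose (a : ℝ) (n : ℕ) :
    ((negBinomCoeff a n : ℝ) : ℂ) = Ring.choose ((a : ℂ) + n - 1) n := by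
  rw [Ring.choose, show (a : ℂ) + n - 1 - n + 1 = a by ring]
  have h := Ring.factorial_nsmul_multichoose_eq_ascPochhammer (a : ℂ) n
  rw [Polynomial.ascPochhammer_smeval_cast, Polynomial.ascPochhammer_smeval_eq_eval,
    nsmul_eq_mul] at h
  have hn : (n.factorial : ℂ) ≠ 0 := by exact_mod_cast n.factorial_ne_zero
  rw [← mul_right_inj' hn, h]
  clear h hn
  induction n with
  | zero => simp [negBinomCoeff]
  | succ n ih =>
    have : ((n : ℂ) + 1) ≠ 0 := by exact_mod_cast n.succ_ne_zero
    rw [ascPochhammer_succ_eval, ← ih, negBinomCoeff, negBinomCoeff, Finset.prod_range_succ,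
      Nat.factorial_succ]
    push_cast
    field_simp

theorem hasSum_negBinomCoeff (a : ℝ) {ζ : ℂ} (hζ : ‖ζ‖ < 1) :
    HasSum (fun n : ℕ => (negBinomCoeff a n : ℂ) * ζ ^ n) (1 / (1 - ζ) ^ (a : ℂ)) := by
  have h := (Complex.one_div_one_sub_cpow_hasFPowerSeriesOnBall_zero (a : ℂ)).hasSum (y := ζ)
    (by simpa [← ofReal_norm] using hζ)
  simp only [zero_add] at h
  refine h.congr_fun fun n => ?_
  rw [negBinomCoeff_eq_choose]
  simp [FormalMultilinearSeries.ofScalars]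

/-- The moments `∫ |w|^(2n) (1 - |w|²)^(c-1) dA` of the radial weight. -/
noncomputable def diskMoment (c : ℝ) (n : ℕ) : ℝ :=
  ∫ w, ‖w‖ ^ (2 * n) * (1 - ‖w‖ ^ 2) ^ (c - 1) ∂diskArea

/-- Polar coordinates and the substitution `t = |w|²`. -/
theorem diskMoment_eq (c : ℝ) (n : ℕ) :
    diskMoment c n = ∫ t in (0 : ℝ)..1, t ^ n * (1 - t) ^ (c - 1) := by
  have hpi := Real.pi_pos
  set g : ℝ → ℝ := (Iio (1 : ℝ)).indicator fun t => t ^ n * (1 - t) ^ (c - 1) with hg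
  have h1 : ∫ w in Metric.ball (0 : ℂ) 1, ‖w‖ ^ (2 * n) * (1 - ‖w‖ ^ 2) ^ (c - 1) =
      ∫ w : ℂ, (fun y => g (y ^ 2)) ‖w‖ := by
    rw [← integral_indicator measurableSet_ball]
    congr 1 with w
    by_cases hw : ‖w‖ < 1
    · have h2 : ‖w‖ ^ 2 ∈ Iio (1 : ℝ) := by simpa using hw
      simp only [hg]
      rw [indicator_of_mem (mem_ball_zero_iff.2 hw), indicator_of_mem h2, pow_mul]
    · have h2 : ‖w‖ ^ 2 ∉ Iio (1 : ℝ) := by simpa using hw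
      simp only [hg]
      rw [indicator_of_notMem (mt mem_ball_zero_iff.1 hw), indicator_of_notMem h2]
  have h2 : ∫ y in Ioi (0 : ℝ), y ^ (2 - 1) • g (y ^ 2) = (∫ y in Ioi (0 : ℝ), g y) / 2 := by
    rw [← integral_comp_rpow_Ioi_of_pos (g := g) two_pos, eq_div_iff two_ne_zero,
      ← integral_mul_const]
    refine setIntegral_congr_fun measurableSet_Ioi fun y _ => ?_
    norm_num
    ring
  have h3 : ∫ y in Ioi (0 : ℝ), g y = ∫ t in (0 : ℝ)..1, t ^ n * (1 - t) ^ (c - 1) := by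
    rw [hg, setIntegral_indicator measurableSet_Iio, Ioi_inter_Iio,
      intervalIntegral.integral_of_le zero_le_one, integral_Ioc_eq_integral_Ioo]
  rw [diskMoment, diskArea, integral_smul_measure, h1,
    integral_fun_norm_addHaar volume fun y => g (y ^ 2),
    Complex.finrank_real_complex, h2, h3, Measure.real, Complex.volume_ball,
    ENNReal.toReal_ofReal (by positivity)]
  simp
  field_simp

/-- The moments invert the coefficients of the Bergman kernel `(1 - ζ)^(-(c+1))`. -/
theorem negBinomCoeff_mul_diskMoment {c : ℝ} (hc : 0 < c) (n : ℕ) :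
    negBinomCoeff (c + 1) n * diskMoment c n = 1 / c := by
  have h1 : ((∫ t in (0 : ℝ)..1, t ^ n * (1 - t) ^ (c - 1) : ℝ) : ℂ) =
      Complex.betaIntegral (n + 1) c := by
    rw [Complex.betaIntegral, ← intervalIntegral.integral_ofReal]
    refine intervalIntegral.integral_congr fun t ht => ?_
    rw [uIcc_of_le zero_le_one] at ht
    push_cast
    rw [Complex.ofReal_cpow (by linarith [ht.2]), add_sub_cancel_right, Complex.cpow_natCast]
    push_cast
    rfl
  rw [Complex.betaIntegral_symm, Complex.betaIntegral_eval_nat_add_one_right (by simpa)] at h1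
  have h2 : ∏ j ∈ Finset.range (n + 1), ((c : ℂ) + j) =
      ((n.factorial * negBinomCoeff (c + 1) n * c : ℝ) : ℂ) := by
    rw [Finset.prod_range_succ', Nat.cast_zero, add_zero]
    push_cast
    congr 1
    clear h1
    induction n with
    | zero => simp [negBinomCoeff]
    | succ n ih =>
      have : ((n : ℂ) + 1) ≠ 0 := by exact_mod_cast n.succ_ne_zero
      rw [Finset.prod_range_succ, ih, negBinomCoeff, negBinomCoeff, Finset.prod_range_succ,
        Nat.factorial_succ]
      push_cast
      field_simp
      ring
  rw [h2] at h1
  rw [← diskMoment_eq] at h1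
  have hn : (n.factorial : ℝ) ≠ 0 := by exact_mod_cast n.factorial_ne_zero
  have hq : negBinomCoeff (c + 1) n ≠ 0 :=
    (Finset.prod_pos fun _ _ => by positivity).ne'
  have h3 : diskMoment c n = n.factorial / (n.factorial * negBinomCoeff (c + 1) n * c) := by
    exact_mod_cast h1
  rw [h3]
  field_simp

theorem summable_norm_of_hasSum {a : ℕ → ℂ} {F : ℂ → ℂ}
    (h : ∀ z : ℂ, ‖z‖ < 1 → HasSum (fun n => a n * z ^ n) (F z)) {z : ℂ} (hz : ‖z‖ < 1) :
    Summable fun n => ‖a n‖ * ‖z‖ ^ n := by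
  have := (h z hz).summable.norm
  simpa [norm_mul, norm_pow] using this

theorem integral_exp_int_mul (n : ℤ) :
    ∫ θ in (0 : ℝ)..2 * Real.pi, Complex.exp (n * Complex.I * θ) =
      if n = 0 then (2 * Real.pi : ℂ) else 0 := by
  split_ifs with h
  · simp [h]
  · have h2 : (n : ℂ) * Complex.I ≠ 0 := by simpa using h
    rw [integral_exp_mul_complex h2]
    have : Complex.exp (n * Complex.I * (2 * Real.pi : ℝ)) = 1 := by
      rw [Complex.exp_eq_one_iff]; exact ⟨n, by push_cast; ring⟩
    rw [this]; simp

/-- Integration over a circle picks out one Taylor coefficient. -/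
theorem integral_conj_pow_mul_circle {a : ℕ → ℂ} {F : ℂ → ℂ}
    (h : ∀ z : ℂ, ‖z‖ < 1 → HasSum (fun n => a n * z ^ n) (F z)) {w : ℂ} (hw : ‖w‖ < 1) (k : ℕ) :
    ∫ θ in (0 : ℝ)..2 * Real.pi, conj (Complex.exp (θ * Complex.I) * w) ^ k *
      F (Complex.exp (θ * Complex.I) * w) = 2 * Real.pi * (a k * (‖w‖ ^ (2 * k) : ℝ)) := by
  have hn : ∀ θ : ℝ, ‖Complex.exp (θ * Complex.I) * w‖ = ‖w‖ := fun θ => by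
    rw [norm_mul, Complex.norm_exp_ofReal_mul_I, one_mul]
  have hsum := summable_norm_of_hasSum h hw
  have key := intervalIntegral.hasSum_integral_of_dominated_convergence (μ := volume)
    (a := 0) (b := 2 * Real.pi)
    (F := fun (n : ℕ) (θ : ℝ) => conj (Complex.exp (θ * Complex.I) * w) ^ k *
      (a n * (Complex.exp (θ * Complex.I) * w) ^ n))
    (f := fun θ : ℝ => conj (Complex.exp (θ * Complex.I) * w) ^ k *
      F (Complex.exp (θ * Complex.I) * w))
    (fun n _ => ‖w‖ ^ k * (‖a n‖ * ‖w‖ ^ n))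
    (fun n => (Continuous.aestronglyMeasurable (by fun_prop)))
    (fun n => ae_of_all _ fun θ _ => by
      rw [norm_mul, norm_pow, RCLike.norm_conj, hn, norm_mul (a n), norm_pow, hn])
    (ae_of_all _ fun θ _ => hsum.mul_left _)
    (by simp)
    (ae_of_all _ fun θ _ => (h _ (by rwa [hn])).mul_left _)
  have hterm : ∀ n : ℕ, ∫ θ in (0 : ℝ)..2 * Real.pi, conj (Complex.exp (θ * Complex.I) * w) ^ k *
      (a n * (Complex.exp (θ * Complex.I) * w) ^ n) =
      if n = k then 2 * Real.pi * (a k * (‖w‖ ^ (2 * k) : ℝ)) else 0 := by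
    intro n
    have e : ∀ θ : ℝ, conj (Complex.exp (θ * Complex.I) * w) ^ k *
        (a n * (Complex.exp (θ * Complex.I) * w) ^ n) =
        (conj w ^ k * (a n * w ^ n)) * Complex.exp (((n - k : ℤ) : ℂ) * Complex.I * θ) := by
      intro θ
      have : Complex.exp (((n - k : ℤ) : ℂ) * Complex.I * θ) =
          conj (Complex.exp (θ * Complex.I)) ^ k * Complex.exp (θ * Complex.I) ^ n := by
        rw [← Complex.exp_conj, ← Complex.exp_nat_mul, ← Complex.exp_nat_mul, ← Complex.exp_add]
        congr 1
        simp only [map_mul, Complex.conj_ofReal, Complex.conj_I]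
        push_cast; ring
      rw [this, map_mul]; ring
    simp_rw [e]
    rw [intervalIntegral.integral_const_mul, integral_exp_int_mul]
    by_cases hnk : n = k
    · subst hnk
      have : conj w ^ n * w ^ n = ((‖w‖ ^ (2 * n) : ℝ) : ℂ) := by
        rw [← mul_pow, Complex.conj_mul', pow_mul]; push_cast; rfl
      simp only [sub_self, if_true, ← this]; ring
    · have : ((n : ℤ) - k) ≠ 0 := by omega
      simp [this, hnk]
  simp_rw [hterm] at key
  exact key.unique (hasSum_ite_eq k _)

/-- Integrating against `w̄^k` with a radial weight picks out the `k`-th Taylor coefficient: by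
rotation invariance of the area the integrand may be averaged over circles. -/
theorem integral_conj_pow_mul_eq {a : ℕ → ℂ} {F : ℂ → ℂ} (hF : Measurable F)
    (h : ∀ z : ℂ, ‖z‖ < 1 → HasSum (fun n => a n * z ^ n) (F z)) (c : ℝ) (k : ℕ)
    (hint : Integrable (fun w => conj w ^ k * F w * (((1 - ‖w‖ ^ 2) ^ (c - 1) : ℝ) : ℂ)) diskArea) :
    ∫ w, conj w ^ k * F w * (((1 - ‖w‖ ^ 2) ^ (c - 1) : ℝ) : ℂ) ∂diskArea =
      a k * diskMoment c k := by
  set G : ℂ → ℂ := fun w => conj w ^ k * F w * (((1 - ‖w‖ ^ 2) ^ (c - 1) : ℝ) : ℂ) with hG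
  have hconj : Measurable fun w : ℂ => conj w := Complex.continuous_conj.measurable
  have hGm : Measurable G := by fun_prop
  have hmp := fun θ : ℝ => measurePreserving_mul_left_diskArea (Complex.norm_exp_ofReal_mul_I θ)
  have hemb := fun θ : ℝ =>
    (Homeomorph.mulLeft₀ _ (Complex.exp_ne_zero (θ * Complex.I))).measurableEmbedding
  have hinv : ∀ θ : ℝ, ∫ w, G (Complex.exp (θ * Complex.I) * w) ∂diskArea = ∫ w, G w ∂diskArea :=
    fun θ => (hmp θ).integral_comp (hemb θ) G
  have hjoint : Integrable (Function.uncurry fun (θ : ℝ) w => G (Complex.exp (θ * Complex.I) * w))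
      ((volume.restrict (uIoc 0 (2 * Real.pi))).prod diskArea) := by
    have hm : Measurable (Function.uncurry fun (θ : ℝ) w => G (Complex.exp (θ * Complex.I) * w)) :=
      hGm.comp (by fun_prop : Continuous fun p : ℝ × ℂ =>
        Complex.exp (p.1 * Complex.I) * p.2).measurable
    rw [integrable_prod_iff hm.aestronglyMeasurable]
    refine ⟨ae_of_all _ fun θ => (hmp θ).integrable_comp_of_integrable hint, ?_⟩
    have : ∀ θ : ℝ, ∫ w, ‖G (Complex.exp (θ * Complex.I) * w)‖ ∂diskArea = ∫ w, ‖G w‖ ∂diskArea :=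
      fun θ => (hmp θ).integral_comp (hemb θ) fun w => ‖G w‖
    simp only [Function.uncurry, this]
    have : IsFiniteMeasure (volume.restrict (uIoc 0 (2 * Real.pi))) :=
      ⟨by rw [uIoc, Measure.restrict_apply_univ]; exact measure_Ioc_lt_top⟩
    exact integrable_const _
  have hswap := intervalIntegral_integral_swap hjoint
  simp_rw [hinv] at hswap
  have hinner : ∀ᵐ w ∂diskArea, ∫ θ in (0 : ℝ)..2 * Real.pi, G (Complex.exp (θ * Complex.I) * w) =
      2 * Real.pi * a k * ((‖w‖ ^ (2 * k) * (1 - ‖w‖ ^ 2) ^ (c - 1) : ℝ) : ℂ) := by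
    filter_upwards [ae_norm_lt_one_diskArea] with w hw
    have hn : ∀ θ : ℝ, ‖Complex.exp (θ * Complex.I) * w‖ = ‖w‖ := fun θ => by
      rw [norm_mul, Complex.norm_exp_ofReal_mul_I, one_mul]
    simp only [hG, hn]
    rw [intervalIntegral.integral_mul_const, integral_conj_pow_mul_circle h hw]
    push_cast; ring
  rw [integral_congr_ae hinner, intervalIntegral.integral_const, integral_const_mul,
    integral_complex_ofReal] at hswap
  have hpi : (2 * Real.pi : ℂ) ≠ 0 := by simp [Real.pi_ne_zero]
  rw [← mul_right_inj' hpi, ← mul_assoc]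
  rw [← diskMoment, sub_zero, Complex.real_smul] at hswap
  push_cast at hswap
  exact hswap

/-- A kernel given by a power series in `w̄ z` may be integrated term by term. -/
theorem hasSum_integral_kernel {κ : ℕ → ℂ} {K : ℂ → ℂ}
    (h : ∀ z : ℂ, ‖z‖ < 1 → HasSum (fun n => κ n * z ^ n) (K z)) {G : ℂ → ℂ}
    (hG : Integrable G diskArea) {z : ℂ} (hz : ‖z‖ < 1) :
    HasSum (fun n => κ n * z ^ n * ∫ w, conj w ^ n * G w ∂diskArea)
      (∫ w, G w * K (conj w * z) ∂diskArea) := by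
  have hK := summable_norm_of_hasSum h hz
  have hint : ∀ n : ℕ, Integrable (fun w => κ n * z ^ n * (conj w ^ n * G w)) diskArea := by
    intro n
    refine Integrable.const_mul (Integrable.bdd_mul (c := 1) hG ?_ ?_) _
    · exact (by fun_prop : Continuous fun w : ℂ => conj w ^ n).aestronglyMeasurable
    · filter_upwards [ae_norm_lt_one_diskArea] with w hw
      rw [norm_pow, RCLike.norm_conj]
      exact pow_le_one₀ (norm_nonneg _) hw.le
  have hle : ∀ n : ℕ, ∫ w, ‖κ n * z ^ n * (conj w ^ n * G w)‖ ∂diskArea ≤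
      ‖κ n‖ * ‖z‖ ^ n * ∫ w, ‖G w‖ ∂diskArea := by
    intro n
    rw [← integral_const_mul]
    refine integral_mono_ae (hint n).norm (hG.norm.const_mul _) ?_
    filter_upwards [ae_norm_lt_one_diskArea] with w hw
    rw [norm_mul, norm_mul, norm_pow, norm_mul, norm_pow, RCLike.norm_conj]
    gcongr
    exact mul_le_of_le_one_left (norm_nonneg _) (pow_le_one₀ (norm_nonneg _) hw.le)
  have key := hasSum_integral_of_summable_integral_norm hint
    ((hK.mul_right _).of_nonneg_of_le (fun n => integral_nonneg fun _ => norm_nonneg _) hle)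
  simp_rw [integral_const_mul] at key
  have hsum : ∫ w, G w * K (conj w * z) ∂diskArea =
      ∫ w, ∑' n, κ n * z ^ n * (conj w ^ n * G w) ∂diskArea := by
    refine integral_congr_ae ?_
    filter_upwards [ae_norm_lt_one_diskArea] with w hw
    have hwz : ‖conj w * z‖ < 1 := by
      rw [norm_mul, RCLike.norm_conj]
      nlinarith [norm_nonneg w, norm_nonneg z]
    rw [← ((h _ hwz).mul_left (G w)).tsum_eq]
    congr 1 with n
    ring
  rw [hsum]
  exact key

/-- Dropping the first `m` terms of the series of `(1 - ζ)^(-a)` and dividing by `ζ^m` does not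
worsen its growth. Passing from `m` to `m + 1`, one divides by `ζ` where `|ζ| ≥ 1/2`; elsewhere the
series is bounded and `|1 - ζ|^(-a)` is bounded below. -/
theorem exists_norm_tsum_negBinomCoeff_le {a : ℝ} (ha : 0 < a) (m : ℕ) :
    (∀ ζ : ℂ, ‖ζ‖ < 1 → Summable fun j : ℕ => (negBinomCoeff a (m + j) : ℂ) * ζ ^ j) ∧
    ∃ C : ℝ, ∀ ζ : ℂ, ‖ζ‖ < 1 →
      ‖∑' j : ℕ, (negBinomCoeff a (m + j) : ℂ) * ζ ^ j‖ ≤ C * ‖1 - ζ‖ ^ (-a) := by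
  have hlow : ∀ ζ : ℂ, ‖ζ‖ < 1 → 1 ≤ (2 : ℝ) ^ a * ‖1 - ζ‖ ^ (-a) := by
    intro ζ hζ
    have h1 : ‖1 - ζ‖ ≤ 2 := by
      calc ‖1 - ζ‖ ≤ ‖(1 : ℂ)‖ + ‖ζ‖ := norm_sub_le _ _
        _ ≤ 2 := by rw [norm_one]; linarith
    have h0 : 0 < ‖1 - ζ‖ := by
      rw [norm_pos_iff, sub_ne_zero]; rintro rfl; simp at hζ
    calc (1 : ℝ) = (2 : ℝ) ^ a * 2 ^ (-a) := by rw [← Real.rpow_add two_pos]; simp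
      _ ≤ _ := by
        gcongr ?_ * ?_
        exact Real.rpow_le_rpow_of_nonpos h0 h1 (by linarith)
  induction m with
  | zero =>
    refine ⟨fun ζ hζ => by simpa using (hasSum_negBinomCoeff a hζ).summable, 1, fun ζ hζ => ?_⟩
    have := (hasSum_negBinomCoeff a hζ).tsum_eq
    simp only [zero_add]
    rw [this, norm_div, norm_one, Complex.norm_cpow_real, one_mul, Real.rpow_neg (norm_nonneg _),
      one_div]
  | succ m ih =>
    obtain ⟨hs, C, hC⟩ := ih
    have hs' : ∀ ζ : ℂ, ‖ζ‖ < 1 →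
        Summable fun j : ℕ => (negBinomCoeff a (m + 1 + j) : ℂ) * ζ ^ j := by
      intro ζ hζ
      rcases eq_or_ne ζ 0 with rfl | h0
      · refine summable_of_ne_finset_zero (s := {0}) fun j hj => ?_
        simp [show j ≠ 0 by simpa using hj]
      · refine (((summable_nat_add_iff 1).2 (hs ζ hζ)).mul_left ζ⁻¹).congr fun j => ?_
        rw [show m + (j + 1) = m + 1 + j by ring, pow_succ]
        field_simp
    refine ⟨hs', ?_⟩
    set T : ℝ := ∑' j : ℕ, negBinomCoeff a (m + 1 + j) * (1 / 2 : ℝ) ^ j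
    have hT : Summable fun j : ℕ => negBinomCoeff a (m + 1 + j) * (1 / 2 : ℝ) ^ j := by
      have := (hs' (1 / 2) (by norm_num)).norm
      refine this.congr fun j => ?_
      rw [norm_mul, norm_pow, Complex.norm_real, Real.norm_of_nonneg (negBinomCoeff_nonneg ha _)]
      norm_num
    have hT0 : 0 ≤ T := tsum_nonneg fun j => mul_nonneg (negBinomCoeff_nonneg ha _) (by positivity)
    have hq := negBinomCoeff_nonneg ha m
    refine ⟨2 * C + 2 * (negBinomCoeff a m * 2 ^ a) + T * 2 ^ a, fun ζ hζ => ?_⟩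
    have hrec : ∑' j : ℕ, (negBinomCoeff a (m + j) : ℂ) * ζ ^ j = negBinomCoeff a m +
        ζ * ∑' j : ℕ, (negBinomCoeff a (m + 1 + j) : ℂ) * ζ ^ j := by
      rw [(hs ζ hζ).tsum_eq_zero_add, ← tsum_mul_left]
      simp only [add_zero, pow_zero, mul_one]
      congr 2 with j
      rw [show m + (j + 1) = m + 1 + j by ring, pow_succ]
      ring
    have hP := Real.rpow_nonneg (norm_nonneg (1 - ζ)) (-a)
    have hl := hlow ζ hζ
    have hCζ := hC ζ hζ
    have hC0 : 0 ≤ C * ‖1 - ζ‖ ^ (-a) := (norm_nonneg _).trans hCζ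
    have hTl := mul_le_mul_of_nonneg_left hl hT0
    have hql := mul_le_mul_of_nonneg_left hl hq
    rcases le_total ‖ζ‖ (1 / 2) with hh | hh
    · have : ‖∑' j : ℕ, (negBinomCoeff a (m + 1 + j) : ℂ) * ζ ^ j‖ ≤ T := by
        refine tsum_of_norm_bounded hT.hasSum fun j => ?_
        rw [norm_mul, norm_pow, Complex.norm_real, Real.norm_of_nonneg (negBinomCoeff_nonneg ha _)]
        have := negBinomCoeff_nonneg ha (m + 1 + j)
        gcongr
      nlinarith
    · set X := ∑' j : ℕ, (negBinomCoeff a (m + 1 + j) : ℂ) * ζ ^ j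
      have h1 : ‖ζ * X‖ ≤ C * ‖1 - ζ‖ ^ (-a) + negBinomCoeff a m := by
        rw [show ζ * X = (∑' j : ℕ, (negBinomCoeff a (m + j) : ℂ) * ζ ^ j) - negBinomCoeff a m by
          rw [hrec]; ring]
        refine (norm_sub_le _ _).trans ?_
        rw [Complex.norm_real, Real.norm_of_nonneg hq]
        gcongr
      rw [norm_mul] at h1
      nlinarith [norm_nonneg X]

/-! ### Carleson densities and the `ν`-derivative -/

theorem isCarlesonMeasure_withDensity_iff {s : ℝ} (hs : 0 ≤ s) {φ u : ℂ → ℝ≥0∞}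
    (h : ∀ z : ℂ, ‖z‖ < 1 → φ z = u z ^ 2) :
    IsCarlesonMeasure s (diskArea.withDensity φ) ↔ IsSqCarleson s u := by
  have : φ =ᵐ[diskArea] fun z => u z ^ 2 := by
    filter_upwards [ae_norm_lt_one_diskArea] with z hz using h z hz
  rw [withDensity_congr_ae this,
    isCarlesonMeasure_iff_ball hs (withDensity_absolutelyContinuous _ _)]
  simp only [IsSqCarleson, withDensity_apply _ measurableSet_ball]

theorem memQ_iff (p β : ℝ) (f : ℂ → ℂ) :
    MemQ p β f ↔ DifferentiableOn ℂ f (Metric.ball 0 1) ∧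
      IsCarlesonMeasure (p + 2 - 2 * β) (diskArea.withDensity fun z =>
        ENNReal.ofReal (‖deriv f z‖ ^ 2 * (1 - ‖z‖ ^ 2) ^ (p - 2 + 2 * β))) := by
  simp only [MemQ, IsCarlesonMeasure, withDensity_apply']

theorem ofReal_norm_sq_mul_rpow (a : ℂ) (t : ℝ) {z : ℂ} (hz : ‖z‖ < 1) :
    ENNReal.ofReal (‖a‖ ^ 2 * (1 - ‖z‖ ^ 2) ^ (2 * t)) = (‖a‖ₑ * diskWeight t z) ^ 2 := by
  rw [mul_pow, diskWeight_sq t hz, diskWeight, ENNReal.ofReal_mul (by positivity),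
    ENNReal.ofReal_pow (norm_nonneg _), ofReal_norm]

theorem IsSqCarleson.mono {s : ℝ} {u v : ℂ → ℝ≥0∞} (hu : IsSqCarleson s u) (A : ℝ≥0)
    (h : ∀ z : ℂ, ‖z‖ < 1 → v z ≤ A * u z) : IsSqCarleson s v := by
  obtain ⟨C, hC⟩ := hu
  refine ⟨A ^ 2 * C, fun ξ hξ r hr => ?_⟩
  calc _ ≤ ∫⁻ w in Metric.ball ξ r, (A : ℝ≥0∞) ^ 2 * u w ^ 2 ∂diskArea := by
        refine lintegral_mono_ae ?_
        filter_upwards [ae_restrict_of_ae ae_norm_lt_one_diskArea] with z hz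
        rw [← mul_pow]
        exact pow_le_pow_left' (h z hz) 2
    _ ≤ _ := by
        rw [lintegral_const_mul' _ _ (by finiteness), ENNReal.coe_mul, ENNReal.coe_pow, mul_assoc]
        gcongr
        exact hC ξ hξ r hr

theorem IsSqCarleson.add {s : ℝ} {u v : ℂ → ℝ≥0∞} (hum : Measurable u) (hu : IsSqCarleson s u)
    (hv : IsSqCarleson s v) : IsSqCarleson s fun z => u z + v z := by
  obtain ⟨C, hC⟩ := hu
  obtain ⟨D, hD⟩ := hv
  refine ⟨4 * (C + D), fun ξ hξ r hr => ?_⟩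
  calc _ ≤ ∫⁻ w in Metric.ball ξ r, 4 * (u w ^ 2 + v w ^ 2) ∂diskArea :=
        lintegral_mono fun w => ENNReal.add_sq_le_four_mul _ _
    _ ≤ 4 * (C * ENNReal.ofReal (r ^ s) + D * ENNReal.ofReal (r ^ s)) := by
        rw [lintegral_const_mul' _ _ (by norm_num), lintegral_add_left (hum.pow_const 2)]
        gcongr
        · exact hC ξ hξ r hr
        · exact hD ξ hξ r hr
    _ = _ := by push_cast; ring

/-- This covers bounded functions times a power of `1 - |z|²`. Small discs follow from the area
estimate; a disc of radius larger than `2` meets the unit disc in no more than one of radius `2`. -/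
theorem isSqCarleson_diskWeight {s t : ℝ} (ht : -1 / 2 < t) (hs : 0 ≤ s) (hst : s ≤ 2 * t + 2) :
    IsSqCarleson s (diskWeight t) := by
  obtain ⟨C, hC⟩ := exists_setLIntegral_diskWeight_ball_le (t := 2 * t) (by linarith)
  refine ⟨C * ((2 : ℝ) ^ (2 * t + 2 - s)).toNNReal, fun ξ hξ r hr => ?_⟩
  have hm : 0 < min r 2 := lt_min hr two_pos
  calc _ ≤ ∫⁻ w in Metric.ball ξ (min r 2), diskWeight (2 * t) w ∂diskArea := by
        rw [← lintegral_indicator measurableSet_ball, ← lintegral_indicator measurableSet_ball]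
        refine lintegral_mono_ae ?_
        filter_upwards [ae_norm_lt_one_diskArea] with w hw
        by_cases h : w ∈ Metric.ball ξ r
        · have h2 : w ∈ Metric.ball ξ (min r 2) := by
            rw [Metric.mem_ball] at h ⊢
            refine lt_min h ?_
            rw [dist_eq_norm]
            linarith [norm_sub_le w ξ]
          rw [indicator_of_mem h, indicator_of_mem h2, diskWeight_sq t hw]
        · rw [indicator_of_notMem h]; exact bot_le
    _ ≤ C * ENNReal.ofReal ((min r 2) ^ (2 * t + 2)) := hC ξ hξ _ hm
    _ ≤ C * ENNReal.ofReal ((2 : ℝ) ^ (2 * t + 2 - s) * r ^ s) := by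
        gcongr
        calc (min r 2) ^ (2 * t + 2) = (min r 2) ^ (2 * t + 2 - s) * (min r 2) ^ s := by
              rw [← Real.rpow_add hm]; congr 1; ring
          _ ≤ _ := by
              gcongr
              · exact min_le_right _ _
              · exact min_le_left _ _
    _ = _ := by
        rw [ENNReal.ofReal_mul (by positivity), ENNReal.coe_mul, ENNReal.ofNNReal_toNNReal,
          mul_assoc]

/-- The disc of radius `2` around `1` contains the unit disc. -/
theorem IsSqCarleson.lintegral_mul_diskWeight_ne_top {s y : ℝ} (hy : -1 / 2 < y)
    {u : ℂ → ℝ≥0∞} (hum : Measurable u) (hu : IsSqCarleson s u) :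
    ∫⁻ w, u w * diskWeight y w ∂diskArea ≠ ∞ := by
  obtain ⟨C, hC⟩ := hu
  obtain ⟨E, hE⟩ := exists_setLIntegral_mul_diskWeight_le (s := s) hy
  have h := hE u (NNReal.sqrt C) hum 1 norm_one 2 two_pos (by
    rw [← ENNReal.coe_pow, NNReal.sq_sqrt]; exact hC 1 norm_one 2 two_pos)
  have h2 : diskArea.restrict (Metric.ball 1 2) = diskArea := by
    refine Measure.restrict_eq_self_of_ae_mem ?_
    filter_upwards [ae_norm_lt_one_diskArea] with w hw
    rw [Metric.mem_ball, dist_eq_norm]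
    linarith [norm_sub_le w 1, norm_one (α := ℂ)]
  rw [h2] at h
  exact ne_top_of_le_ne_top (by finiteness) h

theorem enorm_ofReal_one_sub_norm_sq_rpow (t : ℝ) {w : ℂ} (hw : ‖w‖ < 1) :
    ‖(((1 - ‖w‖ ^ 2) ^ t : ℝ) : ℂ)‖ₑ = diskWeight t w := by
  have h := one_sub_norm_sq_pos hw
  rw [← ofReal_norm, Complex.norm_real, Real.norm_of_nonneg (by positivity), diskWeight]

theorem enorm_conj_pow_le_one {w : ℂ} (hw : ‖w‖ < 1) (k : ℕ) : ‖conj w ^ k‖ₑ ≤ 1 := by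
  rw [← ofReal_norm, ENNReal.ofReal_le_one, norm_pow, RCLike.norm_conj]
  exact pow_le_one₀ (norm_nonneg _) hw.le

theorem integrable_conj_pow_mul (k : ℕ) {F : ℂ → ℂ} (hF : Measurable F) {c : ℝ}
    (h : ∫⁻ w, ‖F w‖ₑ * diskWeight (c - 1) w ∂diskArea ≠ ∞) :
    Integrable (fun w => conj w ^ k * F w * (((1 - ‖w‖ ^ 2) ^ (c - 1) : ℝ) : ℂ)) diskArea := by
  have hconj : Measurable fun w : ℂ => conj w := Complex.continuous_conj.measurable
  refine ⟨(by fun_prop : Measurable _).aestronglyMeasurable, lt_of_le_of_lt ?_ h.lt_top⟩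
  refine lintegral_mono_ae ?_
  filter_upwards [ae_norm_lt_one_diskArea] with w hw
  rw [enorm_mul, enorm_mul, enorm_ofReal_one_sub_norm_sq_rpow _ hw]
  gcongr
  exact mul_le_of_le_one_left' (enorm_conj_pow_le_one hw k)

theorem fracDerivIntegrand_eq (b ν : ℝ) (f : ℂ → ℂ) (z w : ℂ) :
    fracDerivIntegrand b ν f z w =
      (conj w ^ ⌈ν - 1⌉₊ * deriv f w * (((1 - ‖w‖ ^ 2) ^ (b - 1) : ℝ) : ℂ)) *
        (1 / (1 - conj w * z) ^ ((b + ν : ℝ) : ℂ)) := by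
  rw [fracDerivIntegrand]; ring

theorem measurable_fracDeriv (b ν : ℝ) (f : ℂ → ℂ) : Measurable (fracDeriv b ν f) := by
  have hconj : Measurable fun w : ℂ => conj w := Complex.continuous_conj.measurable
  have hd := measurable_deriv f
  have : Measurable (Function.uncurry (fracDerivIntegrand b ν f)) := by
    unfold Function.uncurry fracDerivIntegrand
    fun_prop
  exact (this.stronglyMeasurable.integral_prod_right).measurable.const_mul _

theorem hasFracDeriv_of_integrable {b ν : ℝ} (h0 : 0 ≤ b + ν) {f : ℂ → ℂ}
    (h : Integrable (fun w => conj w ^ ⌈ν - 1⌉₊ * deriv f w *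
      (((1 - ‖w‖ ^ 2) ^ (b - 1) : ℝ) : ℂ)) diskArea) : HasFracDeriv b ν f := by
  intro z hz
  rw [mem_ball_zero_iff] at hz
  have hconj : Measurable fun w : ℂ => conj w := Complex.continuous_conj.measurable
  have e : fracDerivIntegrand b ν f z = fun w => (conj w ^ ⌈ν - 1⌉₊ * deriv f w *
      (((1 - ‖w‖ ^ 2) ^ (b - 1) : ℝ) : ℂ)) * (1 / (1 - conj w * z) ^ ((b + ν : ℝ) : ℂ)) :=
    funext fun w => fracDerivIntegrand_eq b ν f z w
  rw [e]
  refine Integrable.mul_bdd (c := (1 - ‖z‖) ^ (-(b + ν))) h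
    (by fun_prop : Measurable _).aestronglyMeasurable ?_
  filter_upwards [ae_norm_lt_one_diskArea] with w hw
  rw [norm_div, norm_one, Complex.norm_cpow_real, one_div, ← Real.rpow_neg (norm_nonneg _)]
  exact Real.rpow_le_rpow_of_nonpos (by linarith) (one_sub_norm_le_norm_one_sub_conj_mul hw)
    (by linarith)

/-- The integral defining the `ν`-derivative at `z = 0` has kernel `1`. -/
theorem HasFracDeriv.integrable {b ν : ℝ} {f : ℂ → ℂ} (h : HasFracDeriv b ν f) :
    Integrable (fun w => conj w ^ ⌈ν - 1⌉₊ * deriv f w *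
      (((1 - ‖w‖ ^ 2) ^ (b - 1) : ℝ) : ℂ)) diskArea := by
  refine (h 0 (by simp)).congr (ae_of_all _ fun w => ?_)
  simp [fracDerivIntegrand]

theorem lintegral_bergmanKernel_mul_diskWeight {x y t c : ℝ} (hc : t + y = c) (F : ℂ → ℂ) (z : ℂ) :
    ∫⁻ w, bergmanKernel x y z w * (‖F w‖ₑ * diskWeight t w) ∂diskArea =
      diskWeight x z * ∫⁻ w, ‖F w‖ₑ * diskWeight c w *
        ENNReal.ofReal (‖1 - conj w * z‖ ^ (-(2 + x + y))) ∂diskArea := by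
  rw [← lintegral_const_mul' _ _ (diskWeight_ne_top _ _)]
  refine lintegral_congr_ae ?_
  filter_upwards [ae_norm_lt_one_diskArea] with w hw
  rw [bergmanKernel, ← hc, ← diskWeight_mul_diskWeight t y hw]
  ring

theorem enorm_fracDeriv_le (b ν : ℝ) (f : ℂ → ℂ) (z : ℂ) :
    ‖fracDeriv b ν f z‖ₑ ≤ ‖(Real.Gamma (b + ν) / Real.Gamma b : ℝ)‖₊ *
      ∫⁻ w, ‖deriv f w‖ₑ * diskWeight (b - 1) w *
        ENNReal.ofReal (‖1 - conj w * z‖ ^ (-(b + ν))) ∂diskArea := by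
  rw [fracDeriv, enorm_mul]
  gcongr
  · rw [← ofReal_norm, Complex.norm_real, ofReal_norm, enorm_eq_nnnorm]
  refine (enorm_integral_le_lintegral_enorm _).trans (lintegral_mono_ae ?_)
  filter_upwards [ae_norm_lt_one_diskArea] with w hw
  have h4 : ‖1 / (1 - conj w * z) ^ ((b + ν : ℝ) : ℂ)‖ₑ =
      ENNReal.ofReal (‖1 - conj w * z‖ ^ (-(b + ν))) := by
    rw [← ofReal_norm, norm_div, norm_one, Complex.norm_cpow_real, one_div,
      ← Real.rpow_neg (norm_nonneg _)]
  rw [fracDerivIntegrand_eq, enorm_mul, enorm_mul, enorm_mul, h4,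
    enorm_ofReal_one_sub_norm_sq_rpow _ hw]
  gcongr
  exact mul_le_of_le_one_left' (enorm_conj_pow_le_one hw _)

/-! ### Recovering `f'` from the `ν`-derivative -/

theorem exists_hasSum_deriv {f : ℂ → ℂ} (hf : DifferentiableOn ℂ f (Metric.ball 0 1)) :
    ∃ a : ℕ → ℂ, ∀ z : ℂ, ‖z‖ < 1 → HasSum (fun n => a n * z ^ n) (deriv f z) := by
  refine ⟨fun n => (n.factorial : ℂ)⁻¹ * iteratedDeriv n (deriv f) 0, fun z hz => ?_⟩
  have h := Complex.hasSum_taylorSeries_on_ball (hf.deriv Metric.isOpen_ball)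
    (mem_ball_zero_iff.2 hz)
  refine h.congr_fun fun n => ?_
  simp only [sub_zero, smul_eq_mul]
  ring

/-- The Taylor series of the `ν`-derivative. The factor `w̄^m`, `m = ⌈ν - 1⌉`, shifts the
coefficients of `f'` by `m`. -/
theorem hasSum_fracDeriv {b ν : ℝ} {f : ℂ → ℂ} {a : ℕ → ℂ}
    (ha : ∀ z : ℂ, ‖z‖ < 1 → HasSum (fun n => a n * z ^ n) (deriv f z))
    (h : HasFracDeriv b ν f) {z : ℂ} (hz : ‖z‖ < 1) :
    HasSum (fun n => (((Real.Gamma (b + ν) / Real.Gamma b : ℝ) : ℂ) * negBinomCoeff (b + ν) n *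
      (a (n + ⌈ν - 1⌉₊) * diskMoment b (n + ⌈ν - 1⌉₊))) * z ^ n) (fracDeriv b ν f z) := by
  set m := ⌈ν - 1⌉₊
  have hG := h.integrable
  have key := (hasSum_integral_kernel (fun z hz => hasSum_negBinomCoeff (b + ν) hz) hG hz).mul_left
    (((Real.Gamma (b + ν) / Real.Gamma b : ℝ) : ℂ))
  simp_rw [← fracDerivIntegrand_eq] at key
  refine key.congr_fun fun n => ?_
  have e : ∀ w : ℂ, conj w ^ n * (conj w ^ m * deriv f w * (((1 - ‖w‖ ^ 2) ^ (b - 1) : ℝ) : ℂ)) =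
      conj w ^ (n + m) * deriv f w * (((1 - ‖w‖ ^ 2) ^ (b - 1) : ℝ) : ℂ) := fun w => by
    rw [pow_add]; ring
  have hint : Integrable (fun w => conj w ^ (n + m) * deriv f w *
      (((1 - ‖w‖ ^ 2) ^ (b - 1) : ℝ) : ℂ)) diskArea := by
    simp_rw [← e]
    refine Integrable.bdd_mul (c := 1) hG
      (by fun_prop : Continuous fun w : ℂ => conj w ^ n).aestronglyMeasurable ?_
    filter_upwards [ae_norm_lt_one_diskArea] with w hw
    rw [norm_pow, RCLike.norm_conj]
    exact pow_le_one₀ (norm_nonneg _) hw.le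
  have h2 := integral_conj_pow_mul_eq (measurable_deriv f) ha b (n + m) hint
  simp_rw [← e] at h2
  rw [h2]
  ring

/-- `f'` is recovered from its `ν`-derivative, up to a polynomial, by a Bergman-type operator. The
moments of the two radial weights cancel the coefficients of the two kernels. -/
theorem exists_enorm_deriv_le {b ν : ℝ} (hb : 0 < b) (hbν : 1 < b + ν) {f : ℂ → ℂ}
    (hf : DifferentiableOn ℂ f (Metric.ball 0 1)) (h : HasFracDeriv b ν f)
    (hfin : ∫⁻ w, ‖fracDeriv b ν f w‖ₑ * diskWeight (b + ν - 2) w ∂diskArea ≠ ∞) :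
    ∃ C₀ C₁ : ℝ≥0, ∀ z : ℂ, ‖z‖ < 1 → ‖deriv f z‖ₑ ≤ C₀ + C₁ *
      ∫⁻ w, ‖fracDeriv b ν f w‖ₑ * diskWeight (b + ν - 2) w *
        ENNReal.ofReal (‖1 - conj w * z‖ ^ (-(b + 1))) ∂diskArea := by
  obtain ⟨a, ha⟩ := exists_hasSum_deriv hf
  set m := ⌈ν - 1⌉₊ with hm
  set g := fracDeriv b ν f
  set γ : ℝ := Real.Gamma (b + ν) / Real.Gamma b with hγ
  have hγ0 : γ ≠ 0 := (div_pos (Real.Gamma_pos_of_pos (by linarith)) (Real.Gamma_pos_of_pos hb)).ne'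
  set c := b + ν - 1 with hc
  have hc0 : 0 < c := by linarith
  have hgm : Measurable g := measurable_fracDeriv b ν f
  rw [show b + ν - 2 = c - 1 by rw [hc]; ring] at hfin ⊢
  obtain ⟨hsum, C, hC⟩ := exists_norm_tsum_negBinomCoeff_le (a := b + 1) (by linarith) m
  have hint := fun k => integrable_conj_pow_mul k hgm hfin
  -- `z ^ m * K (w̄ z)` is, up to the factor `w̄ ^ (-m)`, the tail of the kernel `(1 - w̄ z)^(-(b+1))`
  set K : ℂ → ℂ := fun ζ => ∑' j : ℕ, (negBinomCoeff (b + 1) (m + j) : ℂ) * ζ ^ j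
  set G : ℂ → ℂ := fun w => g w * (((1 - ‖w‖ ^ 2) ^ (c - 1) : ℝ) : ℂ) with hGdef
  have hG : Integrable G diskArea := by simpa [hGdef] using hint 0
  set H : ℂ → ℂ := fun z => ∫ w, G w * K (conj w * z) ∂diskArea
  have hHsum : ∀ z : ℂ, ‖z‖ < 1 →
      HasSum (fun n => (γ / (b * c) : ℂ) * (a (n + m) * z ^ n)) (H z) := by
    intro z hz
    refine (hasSum_integral_kernel (fun z hz => (hsum z hz).hasSum) hG hz).congr_fun fun n => ?_
    have e := integral_conj_pow_mul_eq hgm (fun z hz => hasSum_fracDeriv ha h hz) c n (hint n)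
    have e1 := negBinomCoeff_mul_diskMoment hb (n + m)
    have e2 := negBinomCoeff_mul_diskMoment hc0 n
    rw [show c + 1 = b + ν by rw [hc]; ring] at e2
    have e1' : (negBinomCoeff (b + 1) (n + m) : ℂ) * diskMoment b (n + m) = 1 / b := by
      exact_mod_cast e1
    have e2' : (negBinomCoeff (b + ν) n : ℂ) * diskMoment c n = 1 / c := by exact_mod_cast e2
    simp only [hGdef, ← mul_assoc] at e ⊢
    rw [e, add_comm m n, ← hm, ← hγ]
    calc (γ / (b * c) : ℂ) * a (n + m) * z ^ n
        = γ * a (n + m) * z ^ n * (1 / b) * (1 / c) := by ring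
      _ = _ := by rw [← e1', ← e2']; ring
  have hpoly : ∀ z : ℂ, ‖z‖ < 1 → deriv f z = ∑ i ∈ Finset.range m, a i * z ^ i +
      z ^ m * ((b * c / γ : ℂ) * H z) := by
    intro z hz
    rw [← (ha z hz).tsum_eq, ← (ha z hz).summable.sum_add_tsum_nat_add m]
    congr 1
    rw [← (hHsum z hz).tsum_eq, ← tsum_mul_left, ← tsum_mul_left]
    congr 1 with n
    have : (γ : ℂ) ≠ 0 := by exact_mod_cast hγ0
    have : (b : ℂ) ≠ 0 := by exact_mod_cast hb.ne'
    have : (c : ℂ) ≠ 0 := by exact_mod_cast hc0.ne'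
    rw [pow_add]
    field_simp
  refine ⟨∑ i ∈ Finset.range m, ‖a i‖₊, ‖b * c / γ‖₊ * C.toNNReal, fun z hz => ?_⟩
  have hpow : ∀ n : ℕ, ‖z ^ n‖ₑ ≤ 1 := fun n => by
    rw [← ofReal_norm, ENNReal.ofReal_le_one, norm_pow]
    exact pow_le_one₀ (norm_nonneg _) hz.le
  have hHz : ‖H z‖ₑ ≤ C.toNNReal * ∫⁻ w, ‖g w‖ₑ * diskWeight (c - 1) w *
        ENNReal.ofReal (‖1 - conj w * z‖ ^ (-(b + 1))) ∂diskArea := by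
    rw [← lintegral_const_mul' _ _ ENNReal.coe_ne_top]
    refine (enorm_integral_le_lintegral_enorm _).trans (lintegral_mono_ae ?_)
    filter_upwards [ae_norm_lt_one_diskArea] with w hw
    have hwz : ‖conj w * z‖ < 1 := by
      rw [norm_mul, RCLike.norm_conj]
      nlinarith [norm_nonneg w, norm_nonneg z]
    have h3 : ‖K (conj w * z)‖ₑ ≤
        C.toNNReal * ENNReal.ofReal (‖1 - conj w * z‖ ^ (-(b + 1))) := by
      rw [← ofReal_norm, ENNReal.ofNNReal_toNNReal, ← ENNReal.ofReal_mul' (by positivity)]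
      exact ENNReal.ofReal_le_ofReal (hC _ hwz)
    rw [enorm_mul, hGdef, enorm_mul, enorm_ofReal_one_sub_norm_sq_rpow _ hw]
    calc _ ≤ ‖g w‖ₑ * diskWeight (c - 1) w *
          (C.toNNReal * ENNReal.ofReal (‖1 - conj w * z‖ ^ (-(b + 1)))) := by gcongr
      _ = _ := by ring
  rw [hpoly z hz]
  refine (enorm_add_le _ _).trans (add_le_add ?_ ?_)
  · refine (enorm_sum_le _ _).trans ?_
    push_cast
    refine Finset.sum_le_sum fun i _ => ?_
    rw [enorm_mul]
    exact mul_le_of_le_one_right' (hpow i)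
  · rw [enorm_mul, enorm_mul, ENNReal.coe_mul, mul_assoc (‖b * c / γ‖₊ : ℝ≥0∞)]
    have : ‖(b * c / γ : ℂ)‖ₑ = ‖b * c / γ‖₊ := by
      rw [← enorm_eq_nnnorm, ← ofReal_norm, ← ofReal_norm, ← Complex.norm_real]; push_cast; rfl
    rw [this]
    refine (mul_le_of_le_one_left' (hpow m)).trans ?_
    gcongr

/-! ### The equivalence -/

theorem mainTheorem3 (p β ν b : ℝ) (hβ : 1 / 2 < β) (hβ1 : β ≤ 1)
    (hp : 2 - 2 * β < p) (hp1 : p ≤ 1)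
    (hν : max ((3 - p - 2 * β) / 2) (2 - 2 * β) < ν) (hb : 1 < b)
    (f : ℂ → ℂ) (hf : DifferentiableOn ℂ f (Metric.ball 0 1)) :
    MemQ p β f ↔
      HasFracDeriv b ν f ∧
        IsCarlesonMeasure (p + 2 - 2 * β)
          (diskArea.withDensity fun z =>
            ENNReal.ofReal
              (‖fracDeriv b ν f z‖ ^ 2 * (1 - ‖z‖ ^ 2) ^ (2 * ν + p + 2 * β - 4))) := by
  obtain ⟨hν1, hν2⟩ := max_lt_iff.1 hν
  have hs : 0 ≤ p + 2 - 2 * β := by linarith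
  -- the halved exponents of the weights of `|f'|²` and `|f^{(ν)}|²`
  set τ := (p - 2 + 2 * β) / 2 with hτ
  have hW := measurable_diskWeight
  have hdm : Measurable fun z => ‖deriv f z‖ₑ * diskWeight τ z :=
    (measurable_deriv f).enorm.mul (hW _)
  have hgm : Measurable fun z => ‖fracDeriv b ν f z‖ₑ * diskWeight (τ + ν - 1) z :=
    (measurable_fracDeriv b ν f).enorm.mul (hW _)
  rw [memQ_iff, and_iff_right hf,
    isCarlesonMeasure_withDensity_iff hs (u := fun z => ‖deriv f z‖ₑ * diskWeight τ z)
      fun z hz => by rw [← ofReal_norm_sq_mul_rpow _ _ hz, hτ, mul_div_cancel₀ _ two_ne_zero],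
    isCarlesonMeasure_withDensity_iff hs
      (u := fun z => ‖fracDeriv b ν f z‖ₑ * diskWeight (τ + ν - 1) z)
      fun z hz => by
        rw [← ofReal_norm_sq_mul_rpow _ _ hz,
          show 2 * (τ + ν - 1) = 2 * ν + p + 2 * β - 4 by rw [hτ]; ring]]
  have hy : -1 / 2 < b - 1 - τ := by linarith
  constructor
  · intro h
    have hfin := h.lintegral_mul_diskWeight_ne_top hy hdm
    have hfin' : ∫⁻ w, ‖deriv f w‖ₑ * diskWeight (b - 1) w ∂diskArea ≠ ∞ := by
      convert hfin using 1
      refine lintegral_congr_ae ?_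
      filter_upwards [ae_norm_lt_one_diskArea] with w hw
      rw [mul_assoc, diskWeight_mul_diskWeight _ _ hw, add_sub_cancel]
    refine ⟨hasFracDeriv_of_integrable (by linarith)
      (integrable_conj_pow_mul _ (measurable_deriv f) hfin'), ?_⟩
    refine (h.lintegral_bergmanKernel (x := τ + ν - 1) (y := b - 1 - τ) (by linarith) hy
      (by linarith) hdm).mono ‖(Real.Gamma (b + ν) / Real.Gamma b : ℝ)‖₊ fun z _ => ?_
    rw [lintegral_bergmanKernel_mul_diskWeight (c := b - 1) (by ring),
      show 2 + (τ + ν - 1) + (b - 1 - τ) = b + ν by ring, mul_comm, mul_left_comm]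
    gcongr
    exact enorm_fracDeriv_le b ν f z
  · rintro ⟨hdef, h⟩
    have hfin := h.lintegral_mul_diskWeight_ne_top hy hgm
    have hfin' : ∫⁻ w, ‖fracDeriv b ν f w‖ₑ * diskWeight (b + ν - 2) w ∂diskArea ≠ ∞ := by
      convert hfin using 1
      refine lintegral_congr_ae ?_
      filter_upwards [ae_norm_lt_one_diskArea] with w hw
      rw [mul_assoc, diskWeight_mul_diskWeight _ _ hw]
      ring_nf
    obtain ⟨C₀, C₁, hC⟩ := exists_enorm_deriv_le (by linarith) (by linarith) hf hdef hfin'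
    have h1 : IsSqCarleson (p + 2 - 2 * β) (diskWeight τ) :=
      isSqCarleson_diskWeight (by linarith) hs (by linarith)
    have h2 := h.lintegral_bergmanKernel (x := τ) (y := b - 1 - τ) (by linarith) hy
      (by linarith) hgm
    refine (IsSqCarleson.add (hW τ) h1 h2).mono (max C₀ C₁) fun z hz => ?_
    rw [lintegral_bergmanKernel_mul_diskWeight (c := b + ν - 2) (by ring),
      show 2 + τ + (b - 1 - τ) = b + 1 by ring]
    calc _ ≤ (C₀ + C₁ * ∫⁻ w, ‖fracDeriv b ν f w‖ₑ * diskWeight (b + ν - 2) w *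
            ENNReal.ofReal (‖1 - conj w * z‖ ^ (-(b + 1))) ∂diskArea) * diskWeight τ z :=
          mul_le_mul_left (hC z hz) _
      _ ≤ (max C₀ C₁ : ℝ≥0) * (1 + ∫⁻ w, ‖fracDeriv b ν f w‖ₑ * diskWeight (b + ν - 2) w *
            ENNReal.ofReal (‖1 - conj w * z‖ ^ (-(b + 1))) ∂diskArea) * diskWeight τ z := by
          rw [mul_add, mul_one]
          gcongr
          · exact le_max_left _ _
          · exact le_max_right _ _
      _ = _ := by ring
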